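/- **Setting.** For a positive integer $n$ let $\Delta^{n-1}=\operatorname{conv}\{e_1,\dots,e_n\}\subseteq\mathbb{R}^n$ be the standard simplex, let $\mathbf 1=(1,\dots,1)\in\mathbb R^n$, and let $S=R(\Delta^{n-1})$ be a rotated copy of it, where $R$ is an orthogonal map of $\mathbb{R}^n$ with $R\mathbf 1=\mathbf 1$; its vertices are $Re_1,\dots,Re_n$. For points $x_1,\dots,x_t$ of $\mathbb{R}^n$ let $\hat m_3(u)=\frac1t\sum_{j=1}^t (u\cdot x_j)^3$ be the sample third moment in direction $u$. **Subroutine 1** (with parameters $r,t$). Pick $u(1)$ uniformly at random on the unit sphere $S^{n-1}$. For $i=1,\dots,r$, draw a fresh sample of $t$ independent uniform points of $S$ (independent of everything drawn before), let $\hat m_3$ be its sample third moment, compute $$w(i+1)=\tfrac{n(n+1)(n+2)}{6}\,\nabla \hat m_3(u(i))-\tfrac12 (u(i)\cdot\mathbf 1)^2\,\mathbf 1-\tfrac12 (u(i)\cdot u(i))^2\,\mathbf 1-(u(i)\cdot \mathbf 1)\,u(i),$$ and set $u(i+1)=w(i+1)/\|w(i+1)\|_2$ (with $u(i+1)=0$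 if $w(i+1)=0$). Output $u(r+1)$. **Lemma.** Let $c>0$, $n>20$ and $0<\delta<1$. Suppose that Subroutine 1 runs for $$r=\left\lceil \log_2\frac{4(c+3)\,n^2\ln n}{\delta}\right\rceil$$ iterations and uses a sample of size $$t=\left\lceil 2^{17}\,n^{2c+22}\left(\frac1\delta\right)^2\ln\frac{2n^5 r}{\delta}\right\rceil$$ for each evaluation of the gradient. Then, with probability at least $1-\delta$, Subroutine 1 outputs a vector within Euclidean distance $1/n^c$ of a vertex of $S$. Moreover, over the random choice of the starting point and of all samples, each vertex is equally likely to be the nearest one to the output: for every vertex $v$ of $S$, the probability that $v$ is strictly nearer to the output than all other vertices is exactly $1/n$. -/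

import Mathlib

namespace SimplexVertex

open MeasureTheory

/-- The all-ones vector of `ℝⁿ`. -/
noncomputable def ones (n : ℕ) : EuclideanSpace ℝ (Fin n) :=
  WithLp.toLp 2 fun _ => 1

/-- The standard simplex `Δ^{n-1}` in `ℝⁿ`: nonnegative coordinates summing to `1`. -/
def standardSimplex (n : ℕ) : Set (EuclideanSpace ℝ (Fin n)) :=
  {x | WithLp.ofLp x ∈ stdSimplex ℝ (Fin n)}

/-- The copy of the standard simplex rotated by `R`. -/
def rotatedSimplex {n : ℕ} (R : EuclideanSpace ℝ (Fin n) ≃ₗᵢ[ℝ] EuclideanSpace ℝ (Fin n)) :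
    Set (EuclideanSpace ℝ (Fin n)) :=
  R '' standardSimplex n

/-- The `i`-th vertex of the rotated simplex. -/
noncomputable def rotatedVertex {n : ℕ}
    (R : EuclideanSpace ℝ (Fin n) ≃ₗᵢ[ℝ] EuclideanSpace ℝ (Fin n)) (i : Fin n) :
    EuclideanSpace ℝ (Fin n) :=
  R (EuclideanSpace.single i 1)

/-- The uniform distribution on the rotated simplex: normalized `(n-1)`-dimensional volume. -/
noncomputable def uniformSimplex {n : ℕ}
    (R : EuclideanSpace ℝ (Fin n) ≃ₗᵢ[ℝ] EuclideanSpace ℝ (Fin n)) :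
    Measure (EuclideanSpace ℝ (Fin n)) :=
  ProbabilityTheory.cond (Measure.hausdorffMeasure ((n : ℝ) - 1)) (rotatedSimplex R)

/-- The uniform distribution on the unit sphere `S^{n-1}`: normalized surface measure. -/
noncomputable def uniformSphere (n : ℕ) :
    Measure (Metric.sphere (0 : EuclideanSpace ℝ (Fin n)) 1) :=
  ProbabilityTheory.cond (volume : Measure (EuclideanSpace ℝ (Fin n))).toSphere Set.univ

/-- The third moment `(1/t) ∑ⱼ (u · xⱼ)³` of a sample `x₁, …, x_t` in direction `u`. -/
noncomputable def sampleThirdMoment {n t : ℕ} (x : Fin t → EuclideanSpace ℝ (Fin n))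
    (u : EuclideanSpace ℝ (Fin n)) : ℝ :=
  (1 / (t : ℝ)) * ∑ j, (inner ℝ u (x j)) ^ 3

/-- The vector computed in one iteration, before normalization.
The factor of the gradient is `C_{n-1} = n (n+1) (n+2) / 6`. -/
noncomputable def rawUpdate {n t : ℕ} (x : Fin t → EuclideanSpace ℝ (Fin n))
    (u : EuclideanSpace ℝ (Fin n)) : EuclideanSpace ℝ (Fin n) :=
  ((n : ℝ) * (n + 1) * (n + 2) / 6) • gradient (sampleThirdMoment x) u
    - ((1 / 2 : ℝ) * (inner ℝ u (ones n)) ^ 2) • ones n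
    - ((1 / 2 : ℝ) * (inner ℝ u u) ^ 2) • ones n
    - (inner ℝ u (ones n) : ℝ) • u

/-- One iteration: update with the sample `x`, then divide by the Euclidean norm. -/
noncomputable def step {n t : ℕ} (x : Fin t → EuclideanSpace ℝ (Fin n))
    (u : EuclideanSpace ℝ (Fin n)) : EuclideanSpace ℝ (Fin n) :=
  ‖rawUpdate x u‖⁻¹ • rawUpdate x u

/-- The vector reached from `u` after `r` iterations, the `i`-th of which uses the sample `X i`. -/
noncomputable def output {n t : ℕ} : (r : ℕ) → EuclideanSpace ℝ (Fin n) →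
    (Fin r → Fin t → EuclideanSpace ℝ (Fin n)) → EuclideanSpace ℝ (Fin n)
  | 0, u, _ => u
  | r + 1, u, X => step (X (Fin.last r)) (output r u fun i => X i.castSucc)

/-- The joint law of the randomness of one run: a uniform starting point on the sphere and,
independently of it, `r` fresh samples, each of `t` independent uniform points of the simplex. -/
noncomputable def runLaw {n : ℕ} (t r : ℕ)
    (R : EuclideanSpace ℝ (Fin n) ≃ₗᵢ[ℝ] EuclideanSpace ℝ (Fin n)) :
    Measure (Metric.sphere (0 : EuclideanSpace ℝ (Fin n)) 1 ×
      (Fin r → Fin t → EuclideanSpace ℝ (Fin n))) :=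
  (uniformSphere n).prod (Measure.pi fun _ => Measure.pi fun _ => uniformSimplex R)

end SimplexVertex

namespace SimplexVertex

open MeasureTheory
open scoped Pointwise

/-! The correction terms in `rawUpdate` are chosen so that, for a unit vector `u` and the unrotated
simplex, the expected update is exactly the coordinatewise square of `u` (`rawUpdate_apply_sub_sq`,
from the third moments of the simplex). Squaring and normalizing squares the ratio of every
coordinate to the largest one, so the iteration converges quadratically to a vertex.

Everything commutes with isometries fixing `ones n`, so it suffices to treat the standard simplex
(`outputLaw_eq_map`).

Closeness: three errors are controlled. A uniform starting point has its second largest absolute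
coordinate below `1 - g` times the largest, except with probability `n ^ 2 * g`
(`uniformSphere_not_dominated_le`). Each sample is independent of the current vector, so Hoeffding
applies with `u` fixed and makes every coordinate of the update accurate to `ε = n ^ 3 * η`
(`sampleLaw_not_accurate_le`). Given this accuracy, the ratio `ρ` becomes at most `ρ ^ 2 + 3 * n *
ε` (`Dominated.step`). The scalar recursion `y ↦ y ^ 2 + b` started at `1 - g` is bounded by
`iterate_sq_add_le`, and a small ratio means a small distance to a vertex
(`PosDominated.exists_dist_sq_le`).

Equal likelihood: permuting coordinates preserves the law of the output, so the `n` events "vertex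
`i` is strictly nearest" are equiprobable. They are disjoint and exhaust the space up to ties. Ties
are null because a tie puts the sample on a level set of a nonconstant polynomial
(`outputLaw_succ_tie_null`). -/

/-! ### The update: explicit gradient, measurability, equivariance. -/

lemma hasGradientAt_sampleThirdMoment {n t : ℕ} (x : Fin t → EuclideanSpace ℝ (Fin n))
    (u : EuclideanSpace ℝ (Fin n)) :
    HasGradientAt (sampleThirdMoment x)
      ((1 / (t : ℝ)) • ∑ j, (3 * (inner ℝ u (x j)) ^ 2) • x j) u := by
  rw [hasGradientAt_iff_hasFDerivAt]
  have h : ∀ j, HasFDerivAt (fun u : EuclideanSpace ℝ (Fin n) => (inner ℝ u (x j) : ℝ))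
      (innerSL ℝ (x j)) u := by
    intro j
    refine (innerSL ℝ (x j)).hasFDerivAt.congr_of_eventuallyEq (Filter.Eventually.of_forall ?_)
    intro v
    simp [real_inner_comm]
  have h3 := (HasFDerivAt.fun_sum (u := Finset.univ) fun j _ => (h j).pow 3).const_mul (1 / (t : ℝ))
  refine h3.congr_fderiv ?_
  ext v
  simp [Finset.mul_sum, mul_assoc]

lemma gradient_sampleThirdMoment {n t : ℕ} (x : Fin t → EuclideanSpace ℝ (Fin n))
    (u : EuclideanSpace ℝ (Fin n)) :
    gradient (sampleThirdMoment x) u =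
      (1 / (t : ℝ)) • ∑ j, (3 * (inner ℝ u (x j)) ^ 2) • x j :=
  (hasGradientAt_sampleThirdMoment x u).gradient

lemma continuous_rawUpdate {n t : ℕ} :
    Continuous fun p : EuclideanSpace ℝ (Fin n) × (Fin t → EuclideanSpace ℝ (Fin n)) =>
      rawUpdate p.2 p.1 := by
  simp only [rawUpdate, gradient_sampleThirdMoment]
  fun_prop

lemma measurable_step {n t : ℕ} :
    Measurable fun p : EuclideanSpace ℝ (Fin n) × (Fin t → EuclideanSpace ℝ (Fin n)) =>
      step p.2 p.1 := by
  have h := (continuous_rawUpdate (n := n) (t := t)).measurable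
  exact h.norm.inv.smul h

lemma measurable_output {n t : ℕ} (r : ℕ) :
    Measurable fun p : EuclideanSpace ℝ (Fin n) × (Fin r → Fin t → EuclideanSpace ℝ (Fin n)) =>
      output r p.1 p.2 := by
  induction r with
  | zero => exact measurable_fst
  | succ r ih =>
    have h1 : Measurable fun p : EuclideanSpace ℝ (Fin n) ×
        (Fin (r + 1) → Fin t → EuclideanSpace ℝ (Fin n)) =>
        (p.1, fun i : Fin r => p.2 i.castSucc) := by fun_prop
    have h2 : Measurable fun p : EuclideanSpace ℝ (Fin n) ×
        (Fin (r + 1) → Fin t → EuclideanSpace ℝ (Fin n)) => p.2 (Fin.last r) := by fun_prop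
    have h3 : Measurable fun p : EuclideanSpace ℝ (Fin n) ×
        (Fin (r + 1) → Fin t → EuclideanSpace ℝ (Fin n)) =>
        output r p.1 fun i : Fin r => p.2 i.castSucc := ih.comp h1
    simp only [output]
    exact (measurable_step (n := n) (t := t)).comp
      (f := fun p : EuclideanSpace ℝ (Fin n) × (Fin (r + 1) → Fin t → EuclideanSpace ℝ (Fin n)) =>
        (output r p.1 fun i : Fin r => p.2 i.castSucc, p.2 (Fin.last r))) (h3.prodMk h2)

lemma measurable_output_coe {n t : ℕ} (r : ℕ) :
    Measurable fun p : Metric.sphere (0 : EuclideanSpace ℝ (Fin n)) 1 ×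
        (Fin r → Fin t → EuclideanSpace ℝ (Fin n)) => output r p.1 p.2 :=
  (measurable_output r).comp (f := fun p : Metric.sphere (0 : EuclideanSpace ℝ (Fin n)) 1 ×
    (Fin r → Fin t → EuclideanSpace ℝ (Fin n)) => ((p.1 : EuclideanSpace ℝ (Fin n)), p.2))
    ((measurable_subtype_coe.comp measurable_fst).prodMk measurable_snd)

/-- After the gradient is made explicit, the update is built only from inner products, the sample
points, `u` and `ones n`. -/
lemma rawUpdate_map {n t : ℕ} (Q : EuclideanSpace ℝ (Fin n) ≃ₗᵢ[ℝ] EuclideanSpace ℝ (Fin n))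
    (hQ : Q (ones n) = ones n) (x : Fin t → EuclideanSpace ℝ (Fin n))
    (u : EuclideanSpace ℝ (Fin n)) :
    rawUpdate (fun j => Q (x j)) (Q u) = Q (rawUpdate x u) := by
  have h1 : (inner ℝ (Q u) (ones n) : ℝ) = inner ℝ u (ones n) := by
    conv_lhs => rw [← hQ]
    exact Q.inner_map_map _ _
  simp only [rawUpdate, gradient_sampleThirdMoment, map_sub, map_smul, map_sum, hQ, h1,
    Q.inner_map_map]

lemma step_map {n t : ℕ} (Q : EuclideanSpace ℝ (Fin n) ≃ₗᵢ[ℝ] EuclideanSpace ℝ (Fin n))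
    (hQ : Q (ones n) = ones n) (x : Fin t → EuclideanSpace ℝ (Fin n))
    (u : EuclideanSpace ℝ (Fin n)) :
    step (fun j => Q (x j)) (Q u) = Q (step x u) := by
  simp only [step, rawUpdate_map Q hQ, map_smul, Q.norm_map]

/-! ### The law of the output as a Markov chain. -/

/-- The law of the output after `r` iterations. -/
noncomputable def outputLaw {n : ℕ} (t r : ℕ)
    (R : EuclideanSpace ℝ (Fin n) ≃ₗᵢ[ℝ] EuclideanSpace ℝ (Fin n)) :
    Measure (EuclideanSpace ℝ (Fin n)) :=
  (runLaw t r R).map fun ω => output r (ω.1 : EuclideanSpace ℝ (Fin n)) ω.2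

/-- The law of one sample of `t` independent uniform points of the rotated simplex. -/
noncomputable def sampleLaw {n : ℕ} (t : ℕ)
    (R : EuclideanSpace ℝ (Fin n) ≃ₗᵢ[ℝ] EuclideanSpace ℝ (Fin n)) :
    Measure (Fin t → EuclideanSpace ℝ (Fin n)) :=
  Measure.pi fun _ => uniformSimplex R

instance {n t : ℕ} (R : EuclideanSpace ℝ (Fin n) ≃ₗᵢ[ℝ] EuclideanSpace ℝ (Fin n))
    [IsProbabilityMeasure (uniformSimplex R)] : IsProbabilityMeasure (sampleLaw t R) := by
  unfold sampleLaw; infer_instance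

instance {n t r : ℕ} (R : EuclideanSpace ℝ (Fin n) ≃ₗᵢ[ℝ] EuclideanSpace ℝ (Fin n))
    [IsProbabilityMeasure (uniformSimplex R)] [IsProbabilityMeasure (uniformSphere n)] :
    IsProbabilityMeasure (runLaw t r R) := by
  unfold runLaw; infer_instance

instance {n t r : ℕ} (R : EuclideanSpace ℝ (Fin n) ≃ₗᵢ[ℝ] EuclideanSpace ℝ (Fin n))
    [IsProbabilityMeasure (uniformSimplex R)] [IsProbabilityMeasure (uniformSphere n)] :
    IsProbabilityMeasure (outputLaw t r R) :=
  Measure.isProbabilityMeasure_map (measurable_output_coe r).aemeasurable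

lemma runLaw_setOf_output {n t r : ℕ}
    (R : EuclideanSpace ℝ (Fin n) ≃ₗᵢ[ℝ] EuclideanSpace ℝ (Fin n))
    {s : Set (EuclideanSpace ℝ (Fin n))} (hs : MeasurableSet s) :
    runLaw t r R {ω | output r (ω.1 : EuclideanSpace ℝ (Fin n)) ω.2 ∈ s} = outputLaw t r R s :=
  (Measure.map_apply (measurable_output_coe r) hs).symm

lemma outputLaw_zero {n t : ℕ}
    (R : EuclideanSpace ℝ (Fin n) ≃ₗᵢ[ℝ] EuclideanSpace ℝ (Fin n))
    [IsProbabilityMeasure (uniformSphere n)] :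
    outputLaw t 0 R = (uniformSphere n).map (↑) := by
  unfold outputLaw runLaw output
  have h := Measure.map_map (μ := (uniformSphere n).prod
      (Measure.pi fun _ : Fin 0 => Measure.pi fun _ : Fin t => uniformSimplex R))
    (g := fun u : Metric.sphere (0 : EuclideanSpace ℝ (Fin n)) 1 =>
    (u : EuclideanSpace ℝ (Fin n))) (f := Prod.fst) measurable_subtype_coe measurable_fst
  refine h.symm.trans ?_
  congr 1
  simp

/-- The last sample is split off the product measure; it is independent of the start and of all
earlier samples. All later inductions on the number of iterations rest on this Markov property. -/
lemma outputLaw_succ {n t r : ℕ}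
    (R : EuclideanSpace ℝ (Fin n) ≃ₗᵢ[ℝ] EuclideanSpace ℝ (Fin n))
    [IsProbabilityMeasure (uniformSimplex R)] [IsProbabilityMeasure (uniformSphere n)] :
    outputLaw t (r + 1) R =
      ((outputLaw t r R).prod (sampleLaw t R)).map fun p => step p.2 p.1 := by
  set U := uniformSphere n
  set S := sampleLaw t R with hS
  set P := Measure.pi fun _ : Fin r => S with hP
  have hrun : runLaw t r R = U.prod P := rfl
  have hrun' : runLaw t (r + 1) R = U.prod (Measure.pi fun _ : Fin (r + 1) => S) := rfl
  have e := measurePreserving_piFinSuccAbove (fun _ : Fin (r + 1) => S) (Fin.last r)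
  have m1 := (MeasurePreserving.id U).prod e
  have m2 : MeasurePreserving (fun p : Metric.sphere (0 : EuclideanSpace ℝ (Fin n)) 1 ×
      ((Fin t → EuclideanSpace ℝ (Fin n)) × (Fin r → Fin t → EuclideanSpace ℝ (Fin n))) =>
      ((p.1, p.2.2), p.2.1)) (U.prod (S.prod P)) ((U.prod P).prod S) := by
    have a := (MeasurePreserving.id U).prod (Measure.measurePreserving_swap (μ := S) (ν := P))
    have b := (measurePreserving_prodAssoc U P S).symm
    exact b.comp a
  have m3 := m2.comp m1
  have hprod : (outputLaw t r R).prod S = ((U.prod P).prod S).map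
      (Prod.map (fun ω => output r (ω.1 : EuclideanSpace ℝ (Fin n)) ω.2) id) := by
    rw [← Measure.map_prod_map _ _ (measurable_output_coe r) measurable_id, Measure.map_id]
    rfl
  rw [hprod, Measure.map_map measurable_step ((measurable_output_coe r).prodMap measurable_id),
    ← m3.map_eq, Measure.map_map (measurable_step.comp
      ((measurable_output_coe r).prodMap measurable_id)) m3.measurable]
  unfold outputLaw
  rw [hrun']
  congr 1
  funext ω
  simp only [output, Function.comp_def, Prod.map, MeasurableEquiv.piFinSuccAbove_apply,
    Fin.insertNthEquiv_symm_apply, Fin.removeNth_last, id]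
  rfl

/-! ### The uniform distribution on the simplex. -/

lemma rotatedSimplex_trans {n : ℕ} (P Q : EuclideanSpace ℝ (Fin n) ≃ₗᵢ[ℝ] EuclideanSpace ℝ (Fin n)) :
    rotatedSimplex (P.trans Q) = Q '' rotatedSimplex P := by
  simp [rotatedSimplex, Set.image_image]

lemma rotatedSimplex_refl {n : ℕ} :
    rotatedSimplex (LinearIsometryEquiv.refl ℝ (EuclideanSpace ℝ (Fin n))) = standardSimplex n := by
  simp [rotatedSimplex]

lemma uniformSimplex_trans {n : ℕ} (P Q : EuclideanSpace ℝ (Fin n) ≃ₗᵢ[ℝ] EuclideanSpace ℝ (Fin n)) :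
    uniformSimplex (P.trans Q) = (uniformSimplex P).map Q := by
  have hQ : MeasurableEmbedding Q := Q.toHomeomorph.measurableEmbedding
  ext s hs
  unfold uniformSimplex
  rw [rotatedSimplex_trans, hQ.map_apply, ProbabilityTheory.cond, ProbabilityTheory.cond,
    Measure.smul_apply, Measure.smul_apply, Measure.restrict_apply hs,
    Measure.restrict_apply (hQ.measurable hs)]
  have e : Measure.hausdorffMeasure ((n : ℝ) - 1) (Q '' rotatedSimplex P) =
      Measure.hausdorffMeasure ((n : ℝ) - 1) (rotatedSimplex P) :=
    Q.toIsometryEquiv.hausdorffMeasure_image _ _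
  rw [e]
  congr 1
  · rw [← Q.toIsometryEquiv.hausdorffMeasure_preimage ((n : ℝ) - 1) (s ∩ Q '' rotatedSimplex P)]
    congr 1
    ext x
    simp

lemma mem_standardSimplex {n : ℕ} {x : EuclideanSpace ℝ (Fin n)} :
    x ∈ standardSimplex n ↔ (∀ i, 0 ≤ x i) ∧ ∑ i, x i = 1 := Iff.rfl

lemma isCompact_standardSimplex (n : ℕ) : IsCompact (standardSimplex n) :=
  (EuclideanSpace.equiv (Fin n) ℝ).toHomeomorph.isClosedEmbedding.isCompact_preimage
    (isCompact_stdSimplex ℝ (Fin n))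

/-- The linear hyperplane of vectors whose coordinates sum to zero. -/
noncomputable def sumZero (n : ℕ) : Submodule ℝ (EuclideanSpace ℝ (Fin n)) :=
  (Submodule.span ℝ {ones n})ᗮ

lemma inner_ones_right {n : ℕ} (x : EuclideanSpace ℝ (Fin n)) :
    (inner ℝ x (ones n) : ℝ) = ∑ i, x i := by
  simp [ones, PiLp.inner_apply]

lemma mem_sumZero {n : ℕ} {x : EuclideanSpace ℝ (Fin n)} :
    x ∈ sumZero n ↔ ∑ i, x i = 0 := by
  rw [sumZero, Submodule.mem_orthogonal_singleton_iff_inner_left, inner_ones_right]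

lemma finrank_sumZero {n : ℕ} (hn : 0 < n) :
    (Module.finrank ℝ (sumZero n) : ℝ) = (n : ℝ) - 1 := by
  have h := Submodule.finrank_add_finrank_orthogonal (Submodule.span ℝ {ones n})
  have h1 : ones n ≠ 0 := by
    intro h0
    have := congrArg (fun v : EuclideanSpace ℝ (Fin n) => v ⟨0, hn⟩) h0
    simp [ones] at this
  rw [finrank_span_singleton h1, finrank_euclideanSpace_fin] at h
  have : Module.finrank ℝ (sumZero n) = Module.finrank ℝ (Submodule.span ℝ {ones n})ᗮ := rfl
  rw [this, eq_sub_iff_add_eq']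
  exact_mod_cast h

/-- The translate of the hyperplane `sumZero n` through the barycenter of the simplex. -/
noncomputable def sumOneEmb (n : ℕ) (v : sumZero n) : EuclideanSpace ℝ (Fin n) :=
  (v : EuclideanSpace ℝ (Fin n)) + (1 / (n : ℝ)) • ones n

lemma isometry_sumOneEmb (n : ℕ) : Isometry (sumOneEmb n) := by
  have := (IsometryEquiv.addRight ((1 / (n : ℝ)) • ones n)).isometry.comp
    (sumZero n).subtypeₗᵢ.isometry
  exact this

lemma standardSimplex_subset_range {n : ℕ} (hn : 0 < n) :
    standardSimplex n ⊆ Set.range (sumOneEmb n) := by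
  intro x hx
  have h : x - (1 / (n : ℝ)) • ones n ∈ sumZero n := by
    rw [mem_sumZero]
    have : (n : ℝ) ≠ 0 := by positivity
    simp [ones, Finset.sum_sub_distrib, (mem_standardSimplex.1 hx).2, this]
  exact ⟨⟨_, h⟩, by simp [sumOneEmb]⟩

/-- Inside the `(n-1)`-dimensional inner product space `sumZero n` the Hausdorff measure of full
dimension is a Haar measure. Finiteness on compact sets, positivity on open sets and null-set
arguments along lines thereby become available. -/
lemma hausdorffMeasure_sumOne {n : ℕ} (hn : 0 < n) {s : Set (EuclideanSpace ℝ (Fin n))}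
    (hs : s ⊆ standardSimplex n) :
    Measure.hausdorffMeasure ((n : ℝ) - 1) s =
      Measure.hausdorffMeasure (Module.finrank ℝ (sumZero n) : ℝ) (sumOneEmb n ⁻¹' s) := by
  rw [(isometry_sumOneEmb n).hausdorffMeasure_preimage (Or.inl (by positivity)),
    Set.inter_eq_left.2 (hs.trans (standardSimplex_subset_range hn)), finrank_sumZero hn]

lemma hausdorffMeasure_standardSimplex_lt_top {n : ℕ} (hn : 0 < n) :
    Measure.hausdorffMeasure ((n : ℝ) - 1) (standardSimplex n) < ⊤ := by
  rw [hausdorffMeasure_sumOne hn subset_rfl]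
  exact ((isometry_sumOneEmb n).isClosedEmbedding.isCompact_preimage
    (isCompact_standardSimplex n)).measure_lt_top

lemma hausdorffMeasure_standardSimplex_pos {n : ℕ} (hn : 0 < n) :
    0 < Measure.hausdorffMeasure ((n : ℝ) - 1) (standardSimplex n) := by
  rw [hausdorffMeasure_sumOne hn subset_rfl]
  have hn' : (n : ℝ) ≠ 0 := by positivity
  have hopen : IsOpen {v : sumZero n | ∀ i, 0 < sumOneEmb n v i} := by
    simp only [Set.ofPred_forall]
    refine isOpen_iInter_of_finite fun i => isOpen_lt continuous_const ?_
    exact (EuclideanSpace.proj i).continuous.comp (isometry_sumOneEmb n).continuous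
  refine (hopen.measure_pos _ ⟨0, fun i => ?_⟩).trans_le (measure_mono fun v hv => ?_)
  · simp [sumOneEmb, ones, hn]
  · refine mem_standardSimplex.2 ⟨fun i => (hv i).le, ?_⟩
    simp [sumOneEmb, ones, Finset.sum_add_distrib, mem_sumZero.1 v.2, hn']

lemma isProbabilityMeasure_uniformSimplex {n : ℕ} (hn : 0 < n)
    (R : EuclideanSpace ℝ (Fin n) ≃ₗᵢ[ℝ] EuclideanSpace ℝ (Fin n)) :
    IsProbabilityMeasure (uniformSimplex R) := by
  have h : Measure.hausdorffMeasure ((n : ℝ) - 1) (rotatedSimplex R) =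
      Measure.hausdorffMeasure ((n : ℝ) - 1) (standardSimplex n) :=
    R.toIsometryEquiv.hausdorffMeasure_image _ _
  refine ProbabilityTheory.cond_isProbabilityMeasure_of_finite ?_ ?_
  · rw [h]; exact (hausdorffMeasure_standardSimplex_pos hn).ne'
  · rw [h]; exact (hausdorffMeasure_standardSimplex_lt_top hn).ne

lemma ae_mem_standardSimplex {n : ℕ} :
    ∀ᵐ x ∂uniformSimplex (LinearIsometryEquiv.refl ℝ (EuclideanSpace ℝ (Fin n))),
      x ∈ standardSimplex n := by
  unfold uniformSimplex
  rw [rotatedSimplex_refl]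
  exact ProbabilityTheory.ae_cond_mem (isCompact_standardSimplex n).isClosed.measurableSet

/-- A measurable set which meets every line in a fixed direction parallel to the simplex in a
null set has probability zero. -/
lemma uniformSimplex_eq_zero_of_lines {n : ℕ} (hn : 0 < n) {s : Set (EuclideanSpace ℝ (Fin n))}
    (hs : MeasurableSet s) {d : EuclideanSpace ℝ (Fin n)} (hd : ∑ i, d i = 0)
    (h : ∀ y, volume {a : ℝ | y + a • d ∈ s} = 0) :
    uniformSimplex (LinearIsometryEquiv.refl ℝ (EuclideanSpace ℝ (Fin n))) s = 0 := by
  unfold uniformSimplex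
  rw [rotatedSimplex_refl, ProbabilityTheory.cond_apply
    (isCompact_standardSimplex n).isClosed.measurableSet]
  refine mul_eq_zero_of_right _ ?_
  rw [hausdorffMeasure_sumOne hn Set.inter_subset_left]
  refine measure_mono_null (Set.preimage_mono Set.inter_subset_right) ?_
  have hm : MeasurableSet (sumOneEmb n ⁻¹' s) := (isometry_sumOneEmb n).continuous.measurable hs
  let L : ℝ →ₗ[ℝ] sumZero n := LinearMap.toSpanSingleton ℝ _ ⟨d, mem_sumZero.2 hd⟩
  have key := ae_mem_of_ae_add_linearMap_mem L volume
    (Measure.hausdorffMeasure (Module.finrank ℝ (sumZero n) : ℝ)) hm.compl ?_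
  · rw [ae_iff] at key
    convert key using 2
    ext v
    simp
  · intro y
    rw [ae_iff]
    refine measure_mono_null (fun a ha => ?_) (h (sumOneEmb n y))
    have : sumOneEmb n (y + L a) ∈ s := by simpa using ha
    have e : sumOneEmb n (y + L a) = sumOneEmb n y + a • d := by
      simp [sumOneEmb, L]; abel
    rw [e] at this
    exact this

/-! ### The uniform distribution on the sphere. -/

/-- The radial projection to the unit sphere, with value `0` at the origin. -/
noncomputable def radial {n : ℕ} (x : EuclideanSpace ℝ (Fin n)) : EuclideanSpace ℝ (Fin n) :=
  ‖x‖⁻¹ • x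

lemma measurable_radial {n : ℕ} : Measurable (radial (n := n)) :=
  measurable_norm.inv.smul measurable_id

lemma isProbabilityMeasure_uniformSphere {n : ℕ} (hn : 0 < n) :
    IsProbabilityMeasure (uniformSphere n) := by
  have : Nonempty (Fin n) := ⟨⟨0, hn⟩⟩
  refine ProbabilityTheory.cond_isProbabilityMeasure ?_
  exact (Measure.measure_univ_ne_zero).2 (Measure.toSphere_ne_zero _)

/-- `toSphere` gives a set `n` times the volume of the cone over it, and normalization cancels the
factor `n`. Questions about the sphere thus become volume computations in the ball. -/
lemma uniformSphere_map_coe {n : ℕ} (hn : 0 < n) :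
    (uniformSphere n).map (↑) =
      (ProbabilityTheory.cond (volume : Measure (EuclideanSpace ℝ (Fin n)))
        (Metric.ball 0 1)).map radial := by
  have : Nonempty (Fin n) := ⟨⟨0, hn⟩⟩
  ext s hs
  have hs' : MeasurableSet ((↑) ⁻¹' s : Set (Metric.sphere (0 : EuclideanSpace ℝ (Fin n)) 1)) :=
    measurable_subtype_coe hs
  rw [Measure.map_apply measurable_subtype_coe hs, Measure.map_apply measurable_radial hs,
    uniformSphere, ProbabilityTheory.cond_apply MeasurableSet.univ,
    ProbabilityTheory.cond_apply Metric.isOpen_ball.measurableSet, Set.univ_inter,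
    Measure.toSphere_apply_univ, Measure.toSphere_apply' _ hs', finrank_euclideanSpace_fin]
  have hset : Set.Ioo (0 : ℝ) 1 • ((fun x : Metric.sphere (0 : EuclideanSpace ℝ (Fin n)) 1 =>
      (x : EuclideanSpace ℝ (Fin n))) '' ((↑) ⁻¹' s)) =
      (Metric.ball 0 1 ∩ radial ⁻¹' s) \ {(0 : EuclideanSpace ℝ (Fin n))} := by
    ext x
    rw [Set.mem_smul]
    constructor
    · rintro ⟨a, ⟨ha0, ha1⟩, _, ⟨y, hy, rfl⟩, rfl⟩
      have hy1 : ‖(y : EuclideanSpace ℝ (Fin n))‖ = 1 := by simp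
      have hn1 : ‖a • (y : EuclideanSpace ℝ (Fin n))‖ = a := by
        rw [norm_smul, hy1, mul_one, Real.norm_of_nonneg ha0.le]
      refine ⟨⟨by rw [mem_ball_zero_iff, hn1]; exact ha1, ?_⟩, ?_⟩
      · rw [Set.mem_preimage, radial, hn1, smul_smul, inv_mul_cancel₀ ha0.ne', one_smul]
        exact hy
      · rw [Set.mem_singleton_iff, ← norm_eq_zero, hn1]
        exact ha0.ne'
    · rintro ⟨⟨hb, hr⟩, h0⟩
      have hx0 : x ≠ 0 := h0
      have hx : 0 < ‖x‖ := norm_pos_iff.2 hx0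
      refine ⟨‖x‖, ⟨hx, mem_ball_zero_iff.1 hb⟩, radial x, ⟨⟨radial x, ?_⟩, hr, rfl⟩, ?_⟩
      · rw [mem_sphere_zero_iff_norm, radial, norm_smul, norm_inv, norm_norm,
          inv_mul_cancel₀ hx.ne']
      · rw [radial, smul_smul, mul_inv_cancel₀ hx.ne', one_smul]
  have hn0 : (n : ENNReal) ≠ 0 := by exact_mod_cast hn.ne'
  rw [hset, measure_sdiff_null (measure_singleton _),
    ENNReal.mul_inv (Or.inl hn0) (Or.inl (ENNReal.natCast_ne_top n)), mul_mul_mul_comm,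
    ENNReal.inv_mul_cancel hn0 (ENNReal.natCast_ne_top n), one_mul]

lemma uniformSphere_map_isometry {n : ℕ} (hn : 0 < n)
    (Q : EuclideanSpace ℝ (Fin n) ≃ₗᵢ[ℝ] EuclideanSpace ℝ (Fin n)) :
    ((uniformSphere n).map ((↑) : _ → EuclideanSpace ℝ (Fin n))).map Q =
      (uniformSphere n).map (↑) := by
  have hQ := Q.measurePreserving
  have hcond : (ProbabilityTheory.cond (volume : Measure (EuclideanSpace ℝ (Fin n)))
        (Metric.ball 0 1)).map Q = ProbabilityTheory.cond volume (Metric.ball 0 1) := by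
    rw [ProbabilityTheory.cond, Measure.map_smul]
    congr 1
    have := hQ.restrict_preimage (s := Metric.ball 0 1) Metric.isOpen_ball.measurableSet
    have hpre : Q ⁻¹' Metric.ball 0 1 = Metric.ball 0 1 := by
      ext x; simp
    rw [hpre] at this
    exact this.map_eq
  rw [uniformSphere_map_coe hn, Measure.map_map Q.continuous.measurable measurable_radial]
  have : Q ∘ radial = radial ∘ Q := by
    funext x; simp [radial]
  rw [this, ← Measure.map_map measurable_radial Q.continuous.measurable, hcond]

/-! ### Invariance of the laws under isometries and permutations. -/

lemma sampleLaw_trans {n t : ℕ} (hn : 0 < n)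
    (P Q : EuclideanSpace ℝ (Fin n) ≃ₗᵢ[ℝ] EuclideanSpace ℝ (Fin n)) :
    sampleLaw t (P.trans Q) = (sampleLaw t P).map fun x j => Q (x j) := by
  have := isProbabilityMeasure_uniformSimplex hn P
  have := isProbabilityMeasure_uniformSimplex hn (P.trans Q)
  refine (measurePreserving_pi _ _ fun _ : Fin t =>
    (⟨Q.continuous.measurable, (uniformSimplex_trans P Q).symm⟩ :
      MeasurePreserving Q (uniformSimplex P) (uniformSimplex (P.trans Q)))).map_eq.symm

lemma outputLaw_trans {n t r : ℕ} (hn : 0 < n)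
    (P Q : EuclideanSpace ℝ (Fin n) ≃ₗᵢ[ℝ] EuclideanSpace ℝ (Fin n)) (hQ : Q (ones n) = ones n) :
    outputLaw t r (P.trans Q) = (outputLaw t r P).map Q := by
  have := isProbabilityMeasure_uniformSimplex hn P
  have := isProbabilityMeasure_uniformSimplex hn (P.trans Q)
  have := isProbabilityMeasure_uniformSphere hn
  have mQ : Measurable Q := Q.continuous.measurable
  induction r with
  | zero => rw [outputLaw_zero, outputLaw_zero, uniformSphere_map_isometry hn]
  | succ r ih =>
    have mQ' : Measurable fun (x : Fin t → EuclideanSpace ℝ (Fin n)) j => Q (x j) := by fun_prop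
    rw [outputLaw_succ, outputLaw_succ, ih, sampleLaw_trans hn, Measure.map_prod_map _ _ mQ mQ',
      Measure.map_map measurable_step (mQ.prodMap mQ'), Measure.map_map mQ measurable_step]
    congr 1
    funext p
    exact step_map Q hQ p.2 p.1

lemma uniformSimplex_perm {n : ℕ} (σ : Equiv.Perm (Fin n)) :
    (uniformSimplex (LinearIsometryEquiv.refl ℝ (EuclideanSpace ℝ (Fin n)))).map
      (LinearIsometryEquiv.piLpCongrLeft 2 ℝ ℝ σ) =
    uniformSimplex (LinearIsometryEquiv.refl ℝ (EuclideanSpace ℝ (Fin n))) := by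
  rw [← uniformSimplex_trans]
  unfold uniformSimplex
  congr 1
  rw [rotatedSimplex_trans, rotatedSimplex_refl]
  ext x
  constructor
  · rintro ⟨y, hy, rfl⟩
    rw [mem_standardSimplex] at hy ⊢
    refine ⟨fun i => hy.1 (σ.symm i), ?_⟩
    rw [← hy.2]
    exact Equiv.sum_comp σ.symm fun i => y i
  · intro hx
    rw [mem_standardSimplex] at hx
    refine ⟨WithLp.toLp 2 fun i => x (σ i),
      mem_standardSimplex.2 ⟨fun i => hx.1 (σ i), ?_⟩, ?_⟩
    · rw [← hx.2]
      exact Equiv.sum_comp σ fun i => x i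
    · ext i
      simp [LinearIsometryEquiv.piLpCongrLeft_apply, Equiv.piCongrLeft']

/-! ### Moments of the uniform distribution up to degree three. -/

/-- The corner of the simplex cut off at `x i = a` is a copy of it shrunk towards the `i`-th vertex.
Scaling of the Hausdorff measure then gives the tail `(1 - a) ^ (n - 1)` of a coordinate. -/
lemma homothety_image_standardSimplex {n : ℕ} (i : Fin n) {a : ℝ} (h0 : 0 ≤ a) (h1 : a < 1) :
    AffineMap.homothety (EuclideanSpace.single i (1 : ℝ)) (1 - a) '' standardSimplex n =
      standardSimplex n ∩ {x | a ≤ x i} := by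
  have hb : 0 < 1 - a := by linarith
  have hs : ∑ j, (EuclideanSpace.single i (1 : ℝ) : EuclideanSpace ℝ (Fin n)) j = 1 := by
    simp
  ext x
  simp only [Set.mem_inter_iff, Set.mem_image, Set.mem_ofPred_eq, mem_standardSimplex]
  constructor
  · rintro ⟨y, ⟨hy0, hy1⟩, rfl⟩
    have hc : ∀ j, AffineMap.homothety (EuclideanSpace.single i (1 : ℝ)) (1 - a) y j =
        (1 - a) * y j + a * (EuclideanSpace.single i (1 : ℝ) : EuclideanSpace ℝ (Fin n)) j := by
      intro j
      simp only [AffineMap.homothety_apply, vsub_eq_sub, vadd_eq_add, PiLp.add_apply,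
        PiLp.smul_apply, PiLp.sub_apply, smul_eq_mul]
      ring
    refine ⟨⟨fun j => ?_, ?_⟩, ?_⟩
    · rw [hc]
      have : 0 ≤ (EuclideanSpace.single i (1 : ℝ) : EuclideanSpace ℝ (Fin n)) j := by
        simp only [PiLp.single_apply]
        split_ifs <;> norm_num
      have := hy0 j
      positivity
    · simp only [hc, Finset.sum_add_distrib, ← Finset.mul_sum, hy1, hs]
      ring
    · rw [hc]
      have := hy0 i
      simp
      positivity
  · rintro ⟨⟨hx0, hx1⟩, hxa⟩
    refine ⟨(1 - a)⁻¹ • (x - a • EuclideanSpace.single i (1 : ℝ)), ⟨fun j => ?_, ?_⟩, ?_⟩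
    · simp only [PiLp.smul_apply, PiLp.sub_apply, smul_eq_mul, PiLp.single_apply]
      refine mul_nonneg (by positivity) ?_
      split_ifs with h
      · subst h; linarith
      · simpa using hx0 j
    · simp only [PiLp.smul_apply, PiLp.sub_apply, smul_eq_mul, ← Finset.mul_sum,
        Finset.sum_sub_distrib, hx1, hs]
      field_simp
    · rw [AffineMap.homothety_apply]
      ext j
      simp only [vsub_eq_sub, vadd_eq_add, PiLp.add_apply, PiLp.smul_apply, PiLp.sub_apply,
        smul_eq_mul]
      field_simp
      ring

lemma uniformSimplex_le_coord {n : ℕ} (hn : 0 < n) (i : Fin n) {a : ℝ} (h0 : 0 ≤ a)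
    (h1 : a < 1) :
    uniformSimplex (LinearIsometryEquiv.refl ℝ (EuclideanSpace ℝ (Fin n))) {x | a ≤ x i} =
      ENNReal.ofReal ((1 - a) ^ (n - 1)) := by
  have hb : 0 < 1 - a := by linarith
  unfold uniformSimplex
  rw [rotatedSimplex_refl, ProbabilityTheory.cond_apply
    (isCompact_standardSimplex n).isClosed.measurableSet, ← homothety_image_standardSimplex i h0 h1,
    hausdorffMeasure_homothety_image (by
      have : (1 : ℝ) ≤ n := by exact_mod_cast hn
      linarith) _ hb.ne']
  have e : ((n : ℝ) - 1) = ((n - 1 : ℕ) : ℝ) := by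
    rw [Nat.cast_pred hn]
  set m := Measure.hausdorffMeasure ((n : ℝ) - 1) (standardSimplex n) with hm
  have hm0 : m ≠ 0 := (hausdorffMeasure_standardSimplex_pos hn).ne'
  have hmt : m ≠ ⊤ := (hausdorffMeasure_standardSimplex_lt_top hn).ne
  rw [e, NNReal.rpow_natCast, ENNReal.smul_def, smul_eq_mul, mul_comm, mul_assoc,
    ENNReal.mul_inv_cancel hm0 hmt, mul_one, ENNReal.coe_pow, ENNReal.ofReal_pow hb.le]
  congr 1
  rw [ENNReal.ofReal, Real.toNNReal_eq_nnnorm_of_nonneg hb.le]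

/-- Layer-cake formula applied to the tail `(1 - a) ^ (n - 1)`, with `(k + 1) * a ^ k` the
derivative of `a ^ (k + 1)`. -/
lemma integral_coord_pow {n : ℕ} (hn : 0 < n) (i : Fin n) (k : ℕ) :
    ∫ x, (x i) ^ (k + 1)
        ∂uniformSimplex (LinearIsometryEquiv.refl ℝ (EuclideanSpace ℝ (Fin n))) =
      ∫ a in (0 : ℝ)..1, (1 - a) ^ (n - 1) * ((k + 1) * a ^ k) := by
  set μ := uniformSimplex (LinearIsometryEquiv.refl ℝ (EuclideanSpace ℝ (Fin n))) with hμ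
  have hmeas : Measurable fun x : EuclideanSpace ℝ (Fin n) => x i := by fun_prop
  have hnn : 0 ≤ᵐ[μ] fun x => x i := by
    filter_upwards [ae_mem_standardSimplex] with x hx using (mem_standardSimplex.1 hx).1 i
  have hle : ∀ᵐ x ∂μ, x i ≤ 1 := by
    filter_upwards [ae_mem_standardSimplex] with x hx
    rw [← (mem_standardSimplex.1 hx).2]
    exact Finset.single_le_sum (fun j _ => (mem_standardSimplex.1 hx).1 j) (Finset.mem_univ i)
  have hg0 : ∀ a : ℝ, 0 ≤ a → 0 ≤ ((k : ℝ) + 1) * a ^ k := fun a ha => by positivity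
  have key := lintegral_comp_eq_lintegral_meas_le_mul μ (f := fun x => x i)
    (g := fun a => ((k : ℝ) + 1) * a ^ k) hnn hmeas.aemeasurable
    (fun t _ => (by fun_prop : Continuous fun a : ℝ => ((k : ℝ) + 1) * a ^ k).intervalIntegrable _ _)
    ((ae_restrict_iff' measurableSet_Ioi).2 (Filter.Eventually.of_forall
      fun a ha => hg0 a (le_of_lt ha)))
  have hint : ∀ b : ℝ, ∫ a in (0 : ℝ)..b, ((k : ℝ) + 1) * a ^ k = b ^ (k + 1) := by
    intro b
    rw [intervalIntegral.integral_const_mul, integral_pow]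
    field_simp
    simp
  simp only [hint] at key
  rw [integral_eq_lintegral_of_nonneg_ae
    (by filter_upwards [hnn] with x hx using pow_nonneg hx _)
    (hmeas.pow_const _).aestronglyMeasurable, key]
  have hF : ∀ a ∈ Set.Ioc (0 : ℝ) 1, 0 ≤ (1 - a) ^ (n - 1) * ((k + 1) * a ^ k) := fun a ha =>
    mul_nonneg (pow_nonneg (by linarith [ha.2]) _) (hg0 a ha.1.le)
  rw [intervalIntegral.integral_of_le zero_le_one, integral_eq_lintegral_of_nonneg_ae
    ((ae_restrict_iff' measurableSet_Ioc).2 (Filter.Eventually.of_forall hF))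
    (by fun_prop : Continuous fun a : ℝ =>
      (1 - a) ^ (n - 1) * (((k : ℝ) + 1) * a ^ k)).aestronglyMeasurable]
  congr 1
  rw [← Set.Ioc_union_Ioi_eq_Ioi zero_le_one, lintegral_union measurableSet_Ioi
    (Set.Ioc_disjoint_Ioi le_rfl)]
  have hz : ∫⁻ a in Set.Ioi (1 : ℝ), μ {x | a ≤ x i} * ENNReal.ofReal (((k : ℝ) + 1) * a ^ k) = 0 := by
    rw [setLIntegral_congr_fun (g := fun _ => 0) measurableSet_Ioi, lintegral_zero]
    intro a ha
    have : μ {x | a ≤ x i} = 0 := by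
      rw [measure_eq_zero_iff_ae_notMem]
      filter_upwards [hle] with x hx hx'
      exact absurd (lt_of_lt_of_le ha hx') (not_lt.2 hx)
    simp [this]
  rw [hz, add_zero, ← restrict_Ioo_eq_restrict_Ioc]
  refine setLIntegral_congr_fun measurableSet_Ioo fun a ha => ?_
  rw [uniformSimplex_le_coord hn i ha.1.le ha.2, ← ENNReal.ofReal_mul
    (pow_nonneg (by linarith [ha.2]) _)]

lemma integral_one_sub_pow_mul (m : ℕ) (c₀ c₁ c₂ : ℝ) :
    ∫ a in (0 : ℝ)..1, (1 - a) ^ m * (c₀ + c₁ * (1 - a) + c₂ * (1 - a) ^ 2) =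
      c₀ / (m + 1) + c₁ / (m + 2) + c₂ / (m + 3) := by
  rw [intervalIntegral.integral_comp_sub_left
    (fun b : ℝ => b ^ m * (c₀ + c₁ * b + c₂ * b ^ 2)) 1]
  have : ∀ b : ℝ, b ^ m * (c₀ + c₁ * b + c₂ * b ^ 2) =
      c₀ * b ^ m + c₁ * b ^ (m + 1) + c₂ * b ^ (m + 2) := fun b => by ring
  simp only [this]
  rw [intervalIntegral.integral_add, intervalIntegral.integral_add]
  · simp only [intervalIntegral.integral_const_mul, integral_pow]
    push_cast
    simp
    ring_nf
  all_goals exact Continuous.intervalIntegrable (by fun_prop) _ _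

lemma integral_coord {n : ℕ} (hn : 0 < n) (i : Fin n) :
    ∫ x, x i ∂uniformSimplex (LinearIsometryEquiv.refl ℝ (EuclideanSpace ℝ (Fin n))) = 1 / n := by
  have h := integral_coord_pow hn i 0
  have h2 := integral_one_sub_pow_mul (n - 1) 1 0 0
  rw [Nat.cast_pred hn] at h2
  simp at h h2 ⊢
  rw [h, h2]

lemma integral_coord_sq {n : ℕ} (hn : 0 < n) (i : Fin n) :
    ∫ x, (x i) ^ 2 ∂uniformSimplex (LinearIsometryEquiv.refl ℝ (EuclideanSpace ℝ (Fin n))) =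
      2 / (n * (n + 1)) := by
  -- The coefficients expand `2 * a` in powers of `1 - a`.
  have h2 := integral_one_sub_pow_mul (n - 1) 2 (-2) 0
  rw [Nat.cast_pred hn] at h2
  rw [integral_coord_pow hn i 1]
  refine (intervalIntegral.integral_congr fun a _ => ?_).trans (h2.trans ?_)
  · push_cast; ring
  · have : (n : ℝ) ≠ 0 := by positivity
    have e : (n : ℝ) - 1 + 2 = n + 1 := by ring
    rw [e]; simp; field_simp; ring

lemma integral_coord_cube {n : ℕ} (hn : 0 < n) (i : Fin n) :
    ∫ x, (x i) ^ 3 ∂uniformSimplex (LinearIsometryEquiv.refl ℝ (EuclideanSpace ℝ (Fin n))) =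
      6 / (n * (n + 1) * (n + 2)) := by
  -- Likewise `3 * a ^ 2 = 3 - 6 * (1 - a) + 3 * (1 - a) ^ 2`.
  have h2 := integral_one_sub_pow_mul (n - 1) 3 (-6) 3
  rw [Nat.cast_pred hn] at h2
  rw [integral_coord_pow hn i 2]
  refine (intervalIntegral.integral_congr fun a _ => ?_).trans (h2.trans ?_)
  · push_cast; ring
  · have : (n : ℝ) ≠ 0 := by positivity
    have e : (n : ℝ) - 1 + 2 = n + 1 := by ring
    have e' : (n : ℝ) - 1 + 3 = n + 2 := by ring
    rw [e, e']; simp; field_simp; ring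

lemma integrable_uniformSimplex {n : ℕ} (hn : 0 < n) {f : EuclideanSpace ℝ (Fin n) → ℝ}
    (hf : Continuous f) :
    Integrable f (uniformSimplex (LinearIsometryEquiv.refl ℝ (EuclideanSpace ℝ (Fin n)))) := by
  have := isProbabilityMeasure_uniformSimplex hn
    (LinearIsometryEquiv.refl ℝ (EuclideanSpace ℝ (Fin n)))
  obtain ⟨C, hC⟩ := (isCompact_standardSimplex n).exists_bound_of_continuousOn hf.continuousOn
  refine Integrable.of_bound hf.aestronglyMeasurable C ?_
  filter_upwards [ae_mem_standardSimplex] with x hx using hC x hx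

lemma integral_perm {n : ℕ} (σ : Equiv.Perm (Fin n)) {f : EuclideanSpace ℝ (Fin n) → ℝ}
    (hf : Continuous f) :
    ∫ x, f (WithLp.toLp 2 fun i => x (σ i))
        ∂uniformSimplex (LinearIsometryEquiv.refl ℝ (EuclideanSpace ℝ (Fin n))) =
      ∫ x, f x ∂uniformSimplex (LinearIsometryEquiv.refl ℝ (EuclideanSpace ℝ (Fin n))) := by
  conv_rhs => rw [← uniformSimplex_perm σ⁻¹]
  rw [integral_map (LinearIsometryEquiv.continuous _).measurable.aemeasurable
    hf.aestronglyMeasurable]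
  rfl

/-- Coordinates sum to one almost surely. With permutation symmetry, this linear relation yields
each mixed moment from moments with fewer distinct indices. -/
lemma sum_integral_mul_coord {n : ℕ} (hn : 0 < n) {f : EuclideanSpace ℝ (Fin n) → ℝ}
    (hf : Continuous f) :
    ∑ j, ∫ x, f x * x j
        ∂uniformSimplex (LinearIsometryEquiv.refl ℝ (EuclideanSpace ℝ (Fin n))) =
      ∫ x, f x ∂uniformSimplex (LinearIsometryEquiv.refl ℝ (EuclideanSpace ℝ (Fin n))) := by
  rw [← integral_finsetSum _ fun j _ => integrable_uniformSimplex hn (by fun_prop)]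
  refine integral_congr_ae ?_
  filter_upwards [ae_mem_standardSimplex] with x hx
  rw [← Finset.mul_sum, (mem_standardSimplex.1 hx).2, mul_one]

lemma integral_coord_mul_coord {n : ℕ} (hn : 0 < n) {a b : Fin n} (hab : a ≠ b) :
    ∫ x, x a * x b ∂uniformSimplex (LinearIsometryEquiv.refl ℝ (EuclideanSpace ℝ (Fin n))) =
      1 / (n * (n + 1)) := by
  set μ := uniformSimplex (LinearIsometryEquiv.refl ℝ (EuclideanSpace ℝ (Fin n))) with hμ
  have hsum := sum_integral_mul_coord hn (f := fun x => x a) (by fun_prop)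
  rw [integral_coord hn, ← Finset.add_sum_erase _ _ (Finset.mem_univ a)] at hsum
  have hc : ∀ j ∈ Finset.univ.erase a, ∫ x, x a * x j ∂μ = ∫ x, x a * x b ∂μ := by
    intro j hj
    have hja : j ≠ a := Finset.ne_of_mem_erase hj
    rw [← integral_perm (Equiv.swap j b) (f := fun x => x a * x b) (by fun_prop)]
    simp [Equiv.swap_apply_of_ne_of_ne hja.symm hab]
    rfl
  have h2 : ∫ x, x a * x a ∂μ = 2 / (n * (n + 1)) := by
    rw [← integral_coord_sq hn a]
    simp only [sq]
    rfl
  rw [Finset.sum_congr rfl hc, Finset.sum_const, Finset.card_erase_of_mem (Finset.mem_univ a),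
    Finset.card_univ, Fintype.card_fin, h2, nsmul_eq_mul, Nat.cast_pred hn] at hsum
  have hn2 : 2 ≤ n := by
    have := a.2; have := b.2
    have : (a : ℕ) ≠ b := fun h => hab (Fin.ext h)
    omega
  have hn1 : (n : ℝ) - 1 ≠ 0 := by
    have : (2 : ℝ) ≤ n := by exact_mod_cast hn2
    linarith
  have hn0 : (n : ℝ) ≠ 0 := by positivity
  have hn0' : (n : ℝ) + 1 ≠ 0 := by positivity
  generalize ∫ x, x a * x b ∂μ = I at hsum ⊢
  field_simp at hsum
  rw [eq_div_iff (by positivity)]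
  apply mul_left_cancel₀ hn1
  linear_combination hsum

lemma integral_coord_sq_mul_coord {n : ℕ} (hn : 0 < n) {a b : Fin n} (hab : a ≠ b) :
    ∫ x, x a * x a * x b
        ∂uniformSimplex (LinearIsometryEquiv.refl ℝ (EuclideanSpace ℝ (Fin n))) =
      2 / (n * (n + 1) * (n + 2)) := by
  set μ := uniformSimplex (LinearIsometryEquiv.refl ℝ (EuclideanSpace ℝ (Fin n))) with hμ
  have hsum := sum_integral_mul_coord hn (f := fun x => x a * x a) (by fun_prop)
  rw [← Finset.add_sum_erase _ _ (Finset.mem_univ a)] at hsum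
  have hc : ∀ j ∈ Finset.univ.erase a, ∫ x, x a * x a * x j ∂μ = ∫ x, x a * x a * x b ∂μ := by
    intro j hj
    have hja : j ≠ a := Finset.ne_of_mem_erase hj
    rw [← integral_perm (Equiv.swap j b) (f := fun x => x a * x a * x b) (by fun_prop)]
    simp [Equiv.swap_apply_of_ne_of_ne hja.symm hab]
    rfl
  have h2 : ∫ x, x a * x a ∂μ = 2 / (n * (n + 1)) := by
    rw [← integral_coord_sq hn a]
    simp only [sq]
    rfl
  have h3 : ∫ x, x a * x a * x a ∂μ = 6 / (n * (n + 1) * (n + 2)) := by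
    rw [← integral_coord_cube hn a]
    exact integral_congr_ae (Filter.Eventually.of_forall fun x => by ring)
  rw [Finset.sum_congr rfl hc, Finset.sum_const, Finset.card_erase_of_mem (Finset.mem_univ a),
    Finset.card_univ, Fintype.card_fin, h2, h3, nsmul_eq_mul, Nat.cast_pred hn] at hsum
  have hn2 : 2 ≤ n := by
    have := a.2; have := b.2
    have : (a : ℕ) ≠ b := fun h => hab (Fin.ext h)
    omega
  have hn1 : (n : ℝ) - 1 ≠ 0 := by
    have : (2 : ℝ) ≤ n := by exact_mod_cast hn2
    linarith
  have hn0 : (n : ℝ) ≠ 0 := by positivity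
  have hn0' : (n : ℝ) + 1 ≠ 0 := by positivity
  have hn0'' : (n : ℝ) + 2 ≠ 0 := by positivity
  generalize ∫ x, x a * x a * x b ∂μ = I at hsum ⊢
  field_simp at hsum
  rw [eq_div_iff (by positivity)]
  apply mul_left_cancel₀ hn1
  linear_combination hsum

lemma integral_coord_mul_coord_mul_coord {n : ℕ} (hn : 0 < n) {a b c : Fin n} (hab : a ≠ b)
    (hac : a ≠ c) (hbc : b ≠ c) :
    ∫ x, x a * x b * x c
        ∂uniformSimplex (LinearIsometryEquiv.refl ℝ (EuclideanSpace ℝ (Fin n))) =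
      1 / (n * (n + 1) * (n + 2)) := by
  set μ := uniformSimplex (LinearIsometryEquiv.refl ℝ (EuclideanSpace ℝ (Fin n))) with hμ
  have hsum := sum_integral_mul_coord hn (f := fun x => x a * x b) (by fun_prop)
  have hb : b ∈ Finset.univ.erase a := Finset.mem_erase.2 ⟨hab.symm, Finset.mem_univ b⟩
  rw [← Finset.add_sum_erase _ _ (Finset.mem_univ a), ← Finset.add_sum_erase _ _ hb] at hsum
  have hc : ∀ j ∈ (Finset.univ.erase a).erase b,
      ∫ x, x a * x b * x j ∂μ = ∫ x, x a * x b * x c ∂μ := by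
    intro j hj
    have hjb : j ≠ b := Finset.ne_of_mem_erase hj
    have hja : j ≠ a := Finset.ne_of_mem_erase (Finset.mem_of_mem_erase hj)
    rw [← integral_perm (Equiv.swap j c) (f := fun x => x a * x b * x c) (by fun_prop)]
    simp [Equiv.swap_apply_of_ne_of_ne hja.symm hac, Equiv.swap_apply_of_ne_of_ne hjb.symm hbc]
    rfl
  have h3 : ∫ x, x a * x b * x a ∂μ = 2 / (n * (n + 1) * (n + 2)) := by
    rw [← integral_coord_sq_mul_coord hn hab]
    exact integral_congr_ae (Filter.Eventually.of_forall fun x => by ring)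
  have h3' : ∫ x, x a * x b * x b ∂μ = 2 / (n * (n + 1) * (n + 2)) := by
    rw [← integral_coord_sq_mul_coord hn hab.symm]
    exact integral_congr_ae (Filter.Eventually.of_forall fun x => by ring)
  have hn3 : 3 ≤ n := by
    have := a.2; have := b.2; have := c.2
    have : (a : ℕ) ≠ b := fun h => hab (Fin.ext h)
    have : (a : ℕ) ≠ c := fun h => hac (Fin.ext h)
    have : (b : ℕ) ≠ c := fun h => hbc (Fin.ext h)
    omega
  rw [Finset.sum_congr rfl hc, Finset.sum_const, Finset.card_erase_of_mem hb,
    Finset.card_erase_of_mem (Finset.mem_univ a), integral_coord_mul_coord hn hab,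
    Finset.card_univ, Fintype.card_fin, h3, h3', nsmul_eq_mul, Nat.sub_sub,
    Nat.cast_sub (by omega : 1 + 1 ≤ n)] at hsum
  have hn1 : (n : ℝ) - 2 ≠ 0 := by
    have : (3 : ℝ) ≤ n := by exact_mod_cast hn3
    linarith
  have hn0 : (n : ℝ) ≠ 0 := by positivity
  have hn0' : (n : ℝ) + 1 ≠ 0 := by positivity
  have hn0'' : (n : ℝ) + 2 ≠ 0 := by positivity
  generalize ∫ x, x a * x b * x c ∂μ = I at hsum ⊢
  push_cast at hsum
  field_simp at hsum
  rw [eq_div_iff (by positivity)]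
  apply mul_left_cancel₀ hn1
  linear_combination hsum

lemma integral_third_moment {n : ℕ} (hn : 0 < n) (a b c : Fin n) :
    ∫ x, x a * x b * x c
        ∂uniformSimplex (LinearIsometryEquiv.refl ℝ (EuclideanSpace ℝ (Fin n))) =
      (1 + (if a = b then 1 else 0) + (if b = c then 1 else 0) + (if a = c then 1 else 0) +
        2 * (if a = b then (if b = c then 1 else 0) else 0)) / (n * (n + 1) * (n + 2)) := by
  by_cases hab : a = b
  · subst hab
    by_cases hac : a = c
    · subst hac
      have h3 := integral_coord_cube hn a
      simp only [if_true]
      norm_num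
      rw [← h3]
      exact integral_congr_ae (Filter.Eventually.of_forall fun x => by ring)
    · rw [integral_coord_sq_mul_coord hn hac]
      simp [hac]
      norm_num
  · by_cases hac : a = c
    · subst hac
      rw [if_neg hab, if_neg (Ne.symm hab), if_pos rfl, if_neg hab]
      norm_num
      rw [← integral_coord_sq_mul_coord hn hab]
      exact integral_congr_ae (Filter.Eventually.of_forall fun x => by ring)
    · by_cases hbc : b = c
      · subst hbc
        rw [if_neg hab, if_pos rfl, if_neg hac]
        norm_num
        rw [← integral_coord_sq_mul_coord hn (Ne.symm hab)]
        exact integral_congr_ae (Filter.Eventually.of_forall fun x => by ring)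
      · rw [integral_coord_mul_coord_mul_coord hn hab hac hbc]
        simp [hab, hac, hbc]

/-! ### The expected update is the coordinatewise square. -/

lemma integral_inner_sq_mul_coord {n : ℕ} (hn : 0 < n) (u : EuclideanSpace ℝ (Fin n))
    (i : Fin n) :
    ∫ x, (inner ℝ u x) ^ 2 * x i
        ∂uniformSimplex (LinearIsometryEquiv.refl ℝ (EuclideanSpace ℝ (Fin n))) =
      ((∑ j, u j) ^ 2 + ∑ j, u j ^ 2 + 2 * u i * ∑ j, u j + 2 * u i ^ 2) /
        (n * (n + 1) * (n + 2)) := by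
  have hexp : ∀ x : EuclideanSpace ℝ (Fin n), (inner ℝ u x) ^ 2 * x i =
      ∑ a, ∑ b, (u a * u b) * (x a * x b * x i) := by
    intro x
    rw [PiLp.inner_apply, sq, Finset.sum_mul_sum, Finset.sum_mul]
    refine Finset.sum_congr rfl fun a _ => ?_
    rw [Finset.sum_mul]
    refine Finset.sum_congr rfl fun b _ => ?_
    simp
    ring
  simp only [hexp]
  rw [integral_finsetSum _ fun a _ => integrable_uniformSimplex hn (by fun_prop)]
  have hin : ∀ a, ∫ x, ∑ b, (u a * u b) * (x a * x b * x i)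
      ∂uniformSimplex (LinearIsometryEquiv.refl ℝ (EuclideanSpace ℝ (Fin n))) =
      (u a * ∑ j, u j + u a * u a + u a * u i + (if a = i then u a * ∑ j, u j else 0) +
        2 * (if a = i then u a * u a else 0)) / (n * (n + 1) * (n + 2)) := by
    intro a
    rw [integral_finsetSum _ fun a _ => integrable_uniformSimplex hn (by fun_prop)]
    simp only [integral_const_mul, integral_third_moment hn, ← mul_div_assoc]
    rw [← Finset.sum_div]
    congr 1
    simp only [mul_add, Finset.sum_add_distrib, mul_ite, mul_one, mul_zero]
    by_cases h : a = i
    · subst h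
      simp [Finset.mul_sum]
      ring
    · simp [h, Finset.mul_sum]
  simp only [hin]
  rw [← Finset.sum_div]
  congr 1
  simp only [Finset.sum_add_distrib, ← Finset.mul_sum, ← Finset.sum_mul]
  simp
  simp only [sq]
  ring

lemma rawUpdate_apply {n t : ℕ} (x : Fin t → EuclideanSpace ℝ (Fin n))
    (u : EuclideanSpace ℝ (Fin n)) (i : Fin n) :
    rawUpdate x u i = (n : ℝ) * (n + 1) * (n + 2) / 2 *
        ((1 / (t : ℝ)) * ∑ j, (inner ℝ u (x j)) ^ 2 * x j i) -
      1 / 2 * (∑ j, u j) ^ 2 - 1 / 2 * (∑ j, u j ^ 2) ^ 2 - (∑ j, u j) * u i := by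
  have h1 : (inner ℝ u u : ℝ) = ∑ j, u j ^ 2 := by
    rw [real_inner_self_eq_norm_sq, EuclideanSpace.real_norm_sq_eq]
  have h2 : (∑ j, (3 * (inner ℝ u (x j)) ^ 2) • x j) i =
      3 * ∑ j, (inner ℝ u (x j)) ^ 2 * x j i := by
    rw [WithLp.ofLp_sum, Finset.sum_apply, Finset.mul_sum]
    refine Finset.sum_congr rfl fun j _ => ?_
    simp [mul_assoc]
  rw [rawUpdate, gradient_sampleThirdMoment, inner_ones_right, h1]
  simp only [PiLp.sub_apply, PiLp.smul_apply, smul_eq_mul, h2]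
  simp only [ones]
  ring

/-- The subtracted terms cancel everything in the exact moment except `u i ^ 2`. The norm condition
is needed because the algorithm subtracts `(u · u) ^ 2` where the moment contains `u · u`. -/
lemma rawUpdate_apply_sub_sq {n t : ℕ} (hn : 0 < n) (x : Fin t → EuclideanSpace ℝ (Fin n))
    {u : EuclideanSpace ℝ (Fin n)} (hu : ‖u‖ = 1) (i : Fin n) :
    rawUpdate x u i - u i ^ 2 = (n : ℝ) * (n + 1) * (n + 2) / 2 *
      ((1 / (t : ℝ)) * ∑ j, (inner ℝ u (x j)) ^ 2 * x j i -
        ∫ y, (inner ℝ u y) ^ 2 * y i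
          ∂uniformSimplex (LinearIsometryEquiv.refl ℝ (EuclideanSpace ℝ (Fin n)))) := by
  have h1 : ∑ j, u j ^ 2 = 1 := by
    rw [← EuclideanSpace.real_norm_sq_eq, hu, one_pow]
  have hn0 : (n : ℝ) ≠ 0 := by positivity
  rw [rawUpdate_apply, integral_inner_sq_mul_coord hn, h1]
  field_simp
  ring

/-! ### Concentration of one update. -/

/-- Two-sided Hoeffding inequality for independent samples of a function with values in `[0, 1]`. -/
lemma hoeffding_pi {Ω : Type*} [MeasurableSpace Ω] (μ : Measure Ω) [IsProbabilityMeasure μ]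
    {f : Ω → ℝ} (hf : Measurable f) (hf01 : ∀ᵐ ω ∂μ, f ω ∈ Set.Icc (0 : ℝ) 1) {t : ℕ}
    {η : ℝ} (hη : 0 ≤ η) :
    (Measure.pi fun _ : Fin t => μ) {x | t * η ≤ |∑ j, (f (x j) - ∫ ω, f ω ∂μ)|} ≤
      ENNReal.ofReal (2 * Real.exp (-(2 * t * η ^ 2))) := by
  set P := Measure.pi fun _ : Fin t => μ with hP
  set m := ∫ ω, f ω ∂μ with hm
  have hind : ProbabilityTheory.iIndepFun (fun (j : Fin t) (x : Fin t → Ω) => f (x j) - m) P :=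
    ProbabilityTheory.iIndepFun_pi (X := fun _ ω => f ω - m) fun _ =>
      (hf.sub_const _).aemeasurable
  have hsub : ∀ j : Fin t, ProbabilityTheory.HasSubgaussianMGF
      (fun x : Fin t → Ω => f (x j) - m) ((‖(1 : ℝ) - 0‖₊ / 2) ^ 2) P := by
    intro j
    have h := ProbabilityTheory.hasSubgaussianMGF_of_mem_Icc (μ := μ) hf.aemeasurable hf01
    have hev := (measurePreserving_eval (fun _ : Fin t => μ) j)
    rw [← hev.map_eq] at h
    have h' := ProbabilityTheory.HasSubgaussianMGF.of_map hev.measurable.aemeasurable h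
    rw [hev.map_eq] at h'
    exact h'
  have hneg : ∀ j : Fin t, ProbabilityTheory.HasSubgaussianMGF
      (fun x : Fin t → Ω => -(f (x j) - m)) ((‖(1 : ℝ) - 0‖₊ / 2) ^ 2) P := fun j => (hsub j).neg
  have hind' : ProbabilityTheory.iIndepFun (fun (j : Fin t) (x : Fin t → Ω) => -(f (x j) - m)) P :=
    ProbabilityTheory.iIndepFun_pi (X := fun _ ω => -(f ω - m)) fun _ =>
      (hf.sub_const _).neg.aemeasurable
  have hε : 0 ≤ (t : ℝ) * η := by positivity
  have e : Real.exp (-((t : ℝ) * η) ^ 2 /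
      (2 * ((∑ _j : Fin t, (‖(1 : ℝ) - 0‖₊ / 2) ^ 2 : NNReal) : ℝ))) ≤
      Real.exp (-(2 * t * η ^ 2)) := by
    refine Real.exp_le_exp.2 (le_of_eq ?_)
    rcases Nat.eq_zero_or_pos t with h0 | h0
    · subst h0; simp
    · have : (t : ℝ) ≠ 0 := by positivity
      simp
      field_simp
  have b1 := (ProbabilityTheory.HasSubgaussianMGF.measure_sum_ge_le_of_iIndepFun hind
    (s := Finset.univ) (fun j _ => hsub j) hε).trans e
  have b2 := (ProbabilityTheory.HasSubgaussianMGF.measure_sum_ge_le_of_iIndepFun hind'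
    (s := Finset.univ) (fun j _ => hneg j) hε).trans e
  have hsubset : {x : Fin t → Ω | t * η ≤ |∑ j, (f (x j) - m)|} ⊆
      {x | t * η ≤ ∑ j, (f (x j) - m)} ∪ {x | t * η ≤ ∑ j, -(f (x j) - m)} := by
    intro x hx
    rcases le_abs.1 (show t * η ≤ |∑ j, (f (x j) - m)| from hx) with h | h
    · exact Or.inl h
    · refine Or.inr ?_
      simpa only [Set.mem_ofPred_eq, Finset.sum_neg_distrib] using h
  rw [ENNReal.le_ofReal_iff_toReal_le (measure_ne_top _ _) (by positivity)]
  calc P.real _ ≤ P.real _ := measureReal_mono hsubset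
    _ ≤ _ := measureReal_union_le _ _
    _ ≤ _ := by linarith

/-- The sample `x` gives an accurate update at `u`: all coordinates are off by at most `ε`. -/
def Accurate {n t : ℕ} (ε : ℝ) (u : EuclideanSpace ℝ (Fin n))
    (x : Fin t → EuclideanSpace ℝ (Fin n)) : Prop :=
  ∀ i, |rawUpdate x u i - u i ^ 2| ≤ ε

lemma sampleLaw_not_accurate_le {n t : ℕ} (hn : 4 ≤ n) (ht : 0 < t) {η : ℝ} (hη : 0 ≤ η)
    {u : EuclideanSpace ℝ (Fin n)} (hu : ‖u‖ = 1) :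
    sampleLaw t (LinearIsometryEquiv.refl ℝ (EuclideanSpace ℝ (Fin n)))
      {x | ¬ Accurate ((n : ℝ) ^ 3 * η) u x} ≤
      ENNReal.ofReal (2 * n * Real.exp (-(2 * t * η ^ 2))) := by
  have hn0 : 0 < n := by omega
  set μ := uniformSimplex (LinearIsometryEquiv.refl ℝ (EuclideanSpace ℝ (Fin n))) with hμ
  have hprob : IsProbabilityMeasure μ := isProbabilityMeasure_uniformSimplex hn0 _
  -- This is `n ^ 2 - 3 * n - 2 ≥ 0`, which first holds at `n = 4`.
  have hcoef : (n : ℝ) * (n + 1) * (n + 2) / 2 ≤ (n : ℝ) ^ 3 := by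
    have : (4 : ℝ) ≤ n := by exact_mod_cast hn
    nlinarith [mul_nonneg (by linarith : (0 : ℝ) ≤ n) (by nlinarith : (0 : ℝ) ≤ n ^ 2 - 3 * n - 2)]
  have hsubset : {x : Fin t → EuclideanSpace ℝ (Fin n) | ¬ Accurate ((n : ℝ) ^ 3 * η) u x} ⊆
      ⋃ i : Fin n, {x | t * η ≤ |∑ j, ((fun y : EuclideanSpace ℝ (Fin n) =>
        (inner ℝ u y) ^ 2 * y i) (x j) - ∫ y, (inner ℝ u y) ^ 2 * y i ∂μ)|} := by
    intro x hx
    simp only [Accurate, Set.mem_ofPred_eq, not_forall, not_le] at hx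
    obtain ⟨i, hi⟩ := hx
    refine Set.mem_iUnion.2 ⟨i, ?_⟩
    rw [Set.mem_ofPred_eq]
    by_contra hlt
    rw [not_le, Finset.sum_sub_distrib, Finset.sum_const, Finset.card_univ, Fintype.card_fin,
      nsmul_eq_mul] at hlt
    refine absurd hi (not_lt.2 ?_)
    have ht' : (0 : ℝ) < t := by exact_mod_cast ht
    rw [rawUpdate_apply_sub_sq hn0 x hu, abs_mul, abs_of_nonneg (by positivity)]
    refine mul_le_mul hcoef ?_ (abs_nonneg _) (by positivity)
    rw [← mul_le_mul_iff_right₀ ht', ← abs_of_pos ht', ← abs_mul, abs_of_pos ht']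
    refine le_trans (le_of_eq ?_) hlt.le
    congr 1
    field_simp
    rfl
  refine (measure_mono hsubset).trans ((measure_iUnion_fintype_le _ _).trans ?_)
  have hb : ∀ i : Fin n, sampleLaw t (LinearIsometryEquiv.refl ℝ (EuclideanSpace ℝ (Fin n)))
      {x | t * η ≤ |∑ j, ((fun y : EuclideanSpace ℝ (Fin n) =>
        (inner ℝ u y) ^ 2 * y i) (x j) - ∫ y, (inner ℝ u y) ^ 2 * y i ∂μ)|} ≤
      ENNReal.ofReal (2 * Real.exp (-(2 * t * η ^ 2))) := by
    intro i
    refine hoeffding_pi μ (f := fun y => (inner ℝ u y) ^ 2 * y i) (by fun_prop) ?_ hη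
    filter_upwards [ae_mem_standardSimplex] with x hx
    rw [mem_standardSimplex] at hx
    have hx1 : ∀ j, x j ≤ 1 := fun j => by
      rw [← hx.2]
      exact Finset.single_le_sum (fun j _ => hx.1 j) (Finset.mem_univ j)
    have hnorm : ‖x‖ ^ 2 ≤ 1 := by
      rw [EuclideanSpace.real_norm_sq_eq, ← hx.2]
      exact Finset.sum_le_sum fun j _ => by nlinarith [hx.1 j, hx1 j]
    have hin : (inner ℝ u x : ℝ) ^ 2 ≤ 1 := by
      have h := abs_real_inner_le_norm u x
      rw [hu, one_mul] at h
      calc (inner ℝ u x : ℝ) ^ 2 = |inner ℝ u x| ^ 2 := (sq_abs _).symm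
        _ ≤ ‖x‖ ^ 2 := by gcongr
        _ ≤ 1 := hnorm
    exact ⟨mul_nonneg (sq_nonneg _) (hx.1 i), mul_le_one₀ hin (hx.1 i) (hx1 i)⟩
  refine (Finset.sum_le_sum fun i _ => hb i).trans (le_of_eq ?_)
  rw [Finset.sum_const, Finset.card_univ, Fintype.card_fin, nsmul_eq_mul, ← ENNReal.ofReal_natCast,
    ← ENNReal.ofReal_mul (Nat.cast_nonneg _)]
  congr 1
  ring

/-! ### Ties between coordinates have probability zero. -/

/-- If the polynomial vanished identically, the root of `k + a * l` would force `c = 0`. Then `p + a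
* q` would vanish at every other point, and two such points give `p = q = 0`. -/
lemma finite_setOf_sq_mul_eq {p q k l c : ℝ} (hl : l ≠ 0) (hpq : p ≠ 0 ∨ q ≠ 0) :
    {a : ℝ | (p + a * q) ^ 2 * (k + a * l) = c}.Finite := by
  set P : Polynomial ℝ := (Polynomial.C p + Polynomial.X * Polynomial.C q) ^ 2 *
    (Polynomial.C k + Polynomial.X * Polynomial.C l) - Polynomial.C c with hPdef
  have hev : ∀ a, P.eval a = (p + a * q) ^ 2 * (k + a * l) - c := fun a => by
    simp [hPdef]; ring
  have hP : P ≠ 0 := by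
    intro h0
    have hz : ∀ a : ℝ, (p + a * q) ^ 2 * (k + a * l) - c = 0 := fun a => by
      rw [← hev, h0, Polynomial.eval_zero]
    have hc : c = 0 := by
      have := hz (-k / l)
      have e : k + -k / l * l = 0 := by field_simp; ring
      rw [e] at this
      linarith
    have hroot : ∀ s : ℝ, s ≠ 0 → p + (-k / l + s) * q = 0 := by
      intro s hs
      have := hz (-k / l + s)
      have e : k + (-k / l + s) * l = s * l := by field_simp; ring
      rw [e, hc, sub_zero] at this
      rcases mul_eq_zero.1 this with h | h
      · exact pow_eq_zero_iff (two_ne_zero) |>.1 h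
      · exact absurd h (mul_ne_zero hs hl)
    have h1 := hroot 1 one_ne_zero
    have h2 := hroot 2 two_ne_zero
    have hq : q = 0 := by linarith
    rw [hq] at h1
    have hp : p = 0 := by linarith
    exact hpq.elim (fun h => h hp) fun h => h hq
  refine (Polynomial.finite_setOfPred_isRoot hP).subset fun a ha => ?_
  have : (p + a * q) ^ 2 * (k + a * l) = c := ha
  simp [Polynomial.IsRoot, hev, this]

lemma uniformSimplex_level_null {n : ℕ} {u : EuclideanSpace ℝ (Fin n)} (hu : u ≠ 0)
    {i j : Fin n} (hij : i ≠ j) (c : ℝ) :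
    uniformSimplex (LinearIsometryEquiv.refl ℝ (EuclideanSpace ℝ (Fin n)))
      {x | (inner ℝ u x) ^ 2 * (x i - x j) = c} = 0 := by
  have hn : 0 < n := i.pos
  -- Lines in direction `e_i - e_k` are used. Either `u` has nonzero slope along them, or `u` is
  -- constant and then `u · x` is a nonzero constant on the hyperplane of coordinate sum one.
  obtain ⟨k, hki, hk⟩ : ∃ k, k ≠ i ∧ (u i ≠ u k ∨ ∀ m, u m = u i) := by
    by_cases h : ∃ k, u k ≠ u i
    · obtain ⟨k, hk⟩ := h
      exact ⟨k, fun h => hk (by rw [h]), Or.inl (Ne.symm hk)⟩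
    · push Not at h
      exact ⟨j, hij.symm, Or.inr h⟩
  set d : EuclideanSpace ℝ (Fin n) := EuclideanSpace.single i 1 - EuclideanSpace.single k 1 with hd
  have hd0 : ∑ m, d m = 0 := by
    simp [hd, Finset.sum_sub_distrib]
  have hq : (inner ℝ u d : ℝ) = u i - u k := by
    rw [hd, inner_sub_right, EuclideanSpace.inner_single_right, EuclideanSpace.inner_single_right]
    simp
  have hl : d i - d j ≠ 0 := by
    simp only [hd, PiLp.sub_apply, PiLp.single_apply, if_neg hki.symm, if_neg hij.symm, if_true]
    split_ifs <;> norm_num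
  have hcl : MeasurableSet {x : EuclideanSpace ℝ (Fin n) |
      ∑ m, x m = 1 ∧ (inner ℝ u x) ^ 2 * (x i - x j) = c} :=
    ((isClosed_eq (by fun_prop) continuous_const).inter
      (isClosed_eq (by fun_prop) continuous_const)).measurableSet
  -- The constraint on the sum is kept because the case of constant `u` needs it on each line.
  have hnull : uniformSimplex (LinearIsometryEquiv.refl ℝ (EuclideanSpace ℝ (Fin n)))
      {x | ∑ m, x m = 1 ∧ (inner ℝ u x) ^ 2 * (x i - x j) = c} = 0 := by
    refine uniformSimplex_eq_zero_of_lines hn hcl hd0 fun y => ?_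
    by_cases hy : ∑ m, y m = 1
    · have hpq : (inner ℝ u y : ℝ) ≠ 0 ∨ (inner ℝ u d : ℝ) ≠ 0 := by
        rcases hk with hk | hk
        · right
          rw [hq]
          exact sub_ne_zero.2 hk
        · left
          have : (inner ℝ u y : ℝ) = u i := by
            simp [PiLp.inner_apply, hk, ← Finset.sum_mul, hy]
          rw [this]
          intro h0
          exact hu (by ext m; simp [hk m, h0])
      refine ((finite_setOf_sq_mul_eq (k := y i - y j) (c := c) hl hpq).subset
        fun a ha => ?_).measure_zero _
      have h2 := ha.2
      simp only [inner_add_right, inner_smul_right, PiLp.add_apply, PiLp.smul_apply,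
        smul_eq_mul] at h2
      rw [Set.mem_ofPred_eq, ← h2]
      ring
    · refine measure_mono_null (t := ∅) (fun a => ?_) measure_empty
      rintro ⟨h, -⟩
      refine absurd ?_ hy
      rw [← h]
      simp [Finset.sum_add_distrib, ← Finset.mul_sum, hd0]
  rw [measure_eq_zero_iff_ae_notMem] at hnull ⊢
  filter_upwards [hnull, ae_mem_standardSimplex] with x hx hxs hx'
  exact hx ⟨(mem_standardSimplex.1 hxs).2, hx'⟩

/-- By Fubini, fixing all variables but the first leaves a single level set of `f`. -/
lemma pi_sum_eq_null {Ω : Type*} [MeasurableSpace Ω] (μ : Measure Ω) [IsProbabilityMeasure μ]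
    {f : Ω → ℝ} (hf : Measurable f) (h : ∀ c, μ {ω | f ω = c} = 0) {t : ℕ} (ht : 0 < t) (c : ℝ) :
    (Measure.pi fun _ : Fin t => μ) {x | ∑ j, f (x j) = c} = 0 := by
  obtain ⟨s, rfl⟩ : ∃ s, t = s + 1 := ⟨t - 1, by omega⟩
  have e := measurePreserving_piFinSuccAbove (fun _ : Fin (s + 1) => μ) 0
  have hm : MeasurableSet {p : Ω × (Fin s → Ω) | f p.1 + ∑ j, f (p.2 j) = c} :=
    measurableSet_eq_fun (by fun_prop) measurable_const
  have h1 := e.measure_preimage hm.nullMeasurableSet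
  have hset : (MeasurableEquiv.piFinSuccAbove (fun _ : Fin (s + 1) => Ω) 0) ⁻¹'
      {p : Ω × (Fin s → Ω) | f p.1 + ∑ j, f (p.2 j) = c} = {x | ∑ j, f (x j) = c} := by
    ext x
    rw [Set.mem_ofPred_eq, Fin.sum_univ_succ]
    rfl
  rw [hset] at h1
  rw [h1, Measure.prod_apply_symm hm, lintegral_eq_zero_iff (measurable_measure_prodMk_right hm)]
  refine Filter.Eventually.of_forall fun y => ?_
  refine measure_mono_null (fun x hx => ?_) (h (c - ∑ j, f (y j)))
  have : f x + ∑ j, f (y j) = c := hx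
  rw [Set.mem_ofPred_eq]
  linarith

lemma sampleLaw_tie_null {n t : ℕ} (ht : 0 < t) {u : EuclideanSpace ℝ (Fin n)} (hu : u ≠ 0)
    {i j : Fin n} (hij : i ≠ j) :
    sampleLaw t (LinearIsometryEquiv.refl ℝ (EuclideanSpace ℝ (Fin n)))
      {x | rawUpdate x u i = rawUpdate x u j} = 0 := by
  have hn : 0 < n := i.pos
  have := isProbabilityMeasure_uniformSimplex hn
    (LinearIsometryEquiv.refl ℝ (EuclideanSpace ℝ (Fin n)))
  set C := (n : ℝ) * (n + 1) * (n + 2) / 2 with hC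
  have hC0 : C ≠ 0 := by positivity
  have ht0 : (t : ℝ) ≠ 0 := by positivity
  refine measure_mono_null (fun x hx => ?_) (pi_sum_eq_null _
    (f := fun x : EuclideanSpace ℝ (Fin n) => (inner ℝ u x) ^ 2 * (x i - x j)) (by fun_prop)
    (fun c => uniformSimplex_level_null hu hij c) ht
    (t / C * ((∑ m, u m) * u i - (∑ m, u m) * u j)))
  have hx' : rawUpdate x u i = rawUpdate x u j := hx
  rw [rawUpdate_apply, rawUpdate_apply, ← hC] at hx'
  rw [Set.mem_ofPred_eq]
  simp only [mul_sub, Finset.sum_sub_distrib]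
  field_simp at hx' ⊢
  linarith

lemma dist_lt_dist_single_iff {n : ℕ} (v : EuclideanSpace ℝ (Fin n)) (i j : Fin n) :
    dist v (EuclideanSpace.single i 1) < dist v (EuclideanSpace.single j 1) ↔ v j < v i := by
  have h : ∀ k, dist v (EuclideanSpace.single k 1) ^ 2 = ‖v‖ ^ 2 - 2 * v k + 1 := by
    intro k
    rw [dist_eq_norm, norm_sub_sq_real, EuclideanSpace.inner_single_right]
    simp
  rw [← sq_lt_sq₀ dist_nonneg dist_nonneg, h, h]
  constructor <;> intro <;> linarith

lemma outputLaw_eq_map {n t r : ℕ} (hn : 0 < n)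
    (R : EuclideanSpace ℝ (Fin n) ≃ₗᵢ[ℝ] EuclideanSpace ℝ (Fin n)) (hR : R (ones n) = ones n) :
    outputLaw t r R =
      (outputLaw t r (LinearIsometryEquiv.refl ℝ (EuclideanSpace ℝ (Fin n)))).map R := by
  rw [← outputLaw_trans hn _ R hR, LinearIsometryEquiv.refl_trans]

lemma outputLaw_perm {n t r : ℕ} (hn : 0 < n) (σ : Equiv.Perm (Fin n)) :
    (outputLaw t r (LinearIsometryEquiv.refl ℝ (EuclideanSpace ℝ (Fin n)))).map
      (LinearIsometryEquiv.piLpCongrLeft 2 ℝ ℝ σ) =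
    outputLaw t r (LinearIsometryEquiv.refl ℝ (EuclideanSpace ℝ (Fin n))) := by
  have hσ : (LinearIsometryEquiv.piLpCongrLeft 2 ℝ ℝ σ) (ones n) = ones n := by
    ext i
    simp [ones, LinearIsometryEquiv.piLpCongrLeft_apply, Equiv.piCongrLeft']
  rw [← outputLaw_trans hn _ _ hσ]
  unfold outputLaw runLaw
  rw [uniformSimplex_trans, uniformSimplex_perm]

lemma outputLaw_succ_tie_null {n t r : ℕ} (ht : 0 < t) {i j : Fin n} (hij : i ≠ j)
    (h0 : outputLaw t r (LinearIsometryEquiv.refl ℝ (EuclideanSpace ℝ (Fin n))) {0} = 0) :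
    outputLaw t (r + 1) (LinearIsometryEquiv.refl ℝ (EuclideanSpace ℝ (Fin n)))
      {v | v i = v j} = 0 := by
  have hn : 0 < n := i.pos
  have := isProbabilityMeasure_uniformSimplex hn
    (LinearIsometryEquiv.refl ℝ (EuclideanSpace ℝ (Fin n)))
  have := isProbabilityMeasure_uniformSphere hn
  have hs : MeasurableSet {v : EuclideanSpace ℝ (Fin n) | v i = v j} :=
    measurableSet_eq_fun (by fun_prop) (by fun_prop)
  rw [outputLaw_succ, Measure.map_apply measurable_step hs,
    Measure.measure_prod_null (measurable_step hs)]
  rw [measure_eq_zero_iff_ae_notMem] at h0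
  filter_upwards [h0] with u hu
  refine measure_mono_null (fun x hx => ?_) (sampleLaw_tie_null ht (u := u) (by simpa using hu) hij)
  have hx' : ‖rawUpdate x u‖⁻¹ * rawUpdate x u i = ‖rawUpdate x u‖⁻¹ * rawUpdate x u j := hx
  rcases mul_eq_mul_left_iff.1 hx' with h | h
  · exact h
  -- If the raw update is `0`, its coordinates are tied as well, so the normalization default
  -- creates no new case.
  · rw [inv_eq_zero, norm_eq_zero] at h
    simp [h]

lemma outputLaw_singleton_zero {n t : ℕ} (hn : 2 ≤ n) (ht : 0 < t) (r : ℕ) :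
    outputLaw t r (LinearIsometryEquiv.refl ℝ (EuclideanSpace ℝ (Fin n))) {0} = 0 := by
  induction r with
  | zero =>
    have := isProbabilityMeasure_uniformSphere (n := n) (by omega)
    rw [outputLaw_zero, Measure.map_apply measurable_subtype_coe (measurableSet_singleton _)]
    convert measure_empty (μ := uniformSphere n)
    ext u
    simp only [Set.mem_preimage, Set.mem_singleton_iff, Set.mem_empty_iff_false, iff_false]
    exact ne_zero_of_mem_unit_sphere u
  | succ r ih =>
    have hij : (⟨0, by omega⟩ : Fin n) ≠ ⟨1, by omega⟩ := by simp
    -- The zero vector is itself a tie between the first two coordinates.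
    refine measure_mono_null ?_ (outputLaw_succ_tie_null ht hij ih)
    rintro v rfl
    simp

/-! ### Each vertex is equally likely to be the nearest. -/

lemma outputLaw_nearest {n t r : ℕ} (hn : 2 ≤ n) (ht : 0 < t) (i : Fin n) :
    outputLaw t (r + 1) (LinearIsometryEquiv.refl ℝ (EuclideanSpace ℝ (Fin n)))
      {v | ∀ j, j ≠ i → v j < v i} = 1 / (n : ENNReal) := by
  have hn0 : 0 < n := by omega
  have := isProbabilityMeasure_uniformSimplex hn0
    (LinearIsometryEquiv.refl ℝ (EuclideanSpace ℝ (Fin n)))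
  have := isProbabilityMeasure_uniformSphere hn0
  set μ := outputLaw t (r + 1) (LinearIsometryEquiv.refl ℝ (EuclideanSpace ℝ (Fin n))) with hμ
  set N : Fin n → Set (EuclideanSpace ℝ (Fin n)) := fun i => {v | ∀ j, j ≠ i → v j < v i} with hN
  have hmeas : ∀ i, MeasurableSet (N i) := by
    intro i
    have : N i = ⋂ j, ⋂ _ : j ≠ i, {v | v j < v i} := by
      ext v; simp [hN]
    rw [this]
    exact MeasurableSet.iInter fun j => MeasurableSet.iInter fun _ =>
      measurableSet_lt (by fun_prop) (by fun_prop)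
  have hsymm : ∀ k, μ (N k) = μ (N i) := by
    intro k
    have hp := outputLaw_perm (t := t) (r := r + 1) hn0 (Equiv.swap k i)
    rw [← hμ] at hp
    conv_lhs => rw [← hp]
    rw [Measure.map_apply (LinearIsometryEquiv.continuous _).measurable (hmeas k)]
    congr 1
    ext v
    have hv : ∀ j, (LinearIsometryEquiv.piLpCongrLeft 2 ℝ ℝ (Equiv.swap k i)) v j =
        v (Equiv.swap k i j) := fun j => by
      simp [LinearIsometryEquiv.piLpCongrLeft_apply, Equiv.piCongrLeft']
    simp only [hN, Set.mem_preimage, Set.mem_ofPred_eq, hv, Equiv.swap_apply_left]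
    constructor
    · intro h j hj
      have := h (Equiv.swap k i j) (fun h' => hj
        ((Equiv.swap_apply_eq_iff.1 h').trans (Equiv.swap_apply_left k i)))
      simpa using this
    · intro h j hj
      exact h _ fun h' => hj
        ((Equiv.swap_apply_eq_iff.1 h').trans (Equiv.swap_apply_right k i))
  have hdisj : Pairwise (Function.onFun Disjoint N) := by
    intro a b hab
    refine Set.disjoint_left.2 fun v ha hb => ?_
    exact lt_asymm (ha b hab.symm) (hb a hab)
  have hunion : μ (⋃ k, N k) = 1 := by
    rw [prob_compl_eq_zero_iff (MeasurableSet.iUnion hmeas) |>.symm]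
    refine measure_mono_null (t := ⋃ a, ⋃ b, ⋃ _ : a ≠ b, {v | v a = v b}) ?_ ?_
    · intro v hv
      by_contra hcon
      simp only [Set.mem_iUnion, not_exists, Set.mem_ofPred_eq] at hcon
      have : Nonempty (Fin n) := ⟨i⟩
      obtain ⟨m, hm⟩ := Finite.exists_max fun k => v k
      exact hv (Set.mem_iUnion.2 ⟨m, fun j hj => lt_of_le_of_ne (hm j) (hcon j m hj)⟩)
    · simp only [measure_iUnion_null_iff]
      intro a b hab
      exact outputLaw_succ_tie_null ht hab (outputLaw_singleton_zero hn ht r)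
  rw [measure_iUnion hdisj hmeas, tsum_fintype, Finset.sum_congr rfl fun k _ => hsymm k,
    Finset.sum_const, Finset.card_univ, Fintype.card_fin, nsmul_eq_mul] at hunion
  rw [ENNReal.eq_div_iff (by exact_mod_cast hn0.ne') (ENNReal.natCast_ne_top n)]
  exact hunion

lemma runLaw_nearest {n t r : ℕ} (hn : 2 ≤ n) (ht : 0 < t) (hr : 0 < r)
    (R : EuclideanSpace ℝ (Fin n) ≃ₗᵢ[ℝ] EuclideanSpace ℝ (Fin n)) (hR : R (ones n) = ones n)
    (i : Fin n) :
    runLaw t r R {ω | ∀ j : Fin n, j ≠ i →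
      dist (output r (ω.1 : EuclideanSpace ℝ (Fin n)) ω.2) (rotatedVertex R i) <
        dist (output r (ω.1 : EuclideanSpace ℝ (Fin n)) ω.2) (rotatedVertex R j)} =
      1 / (n : ENNReal) := by
  obtain ⟨s, rfl⟩ : ∃ s, r = s + 1 := ⟨r - 1, by omega⟩
  have hm : MeasurableSet {v : EuclideanSpace ℝ (Fin n) | ∀ j, j ≠ i →
      dist v (rotatedVertex R i) < dist v (rotatedVertex R j)} := by
    simp only [Set.ofPred_forall]
    exact MeasurableSet.iInter fun j => MeasurableSet.iInter fun _ =>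
      measurableSet_lt (by fun_prop) (by fun_prop)
  rw [← outputLaw_nearest (r := s) hn ht i]
  refine (runLaw_setOf_output R hm).trans ?_
  rw [outputLaw_eq_map (by omega) R hR, Measure.map_apply R.continuous.measurable hm]
  congr 1
  ext v
  simp only [Set.mem_preimage, Set.mem_ofPred_eq, rotatedVertex, R.dist_map,
    dist_lt_dist_single_iff]

/-! ### One accurate iteration squares the ratio of coordinates. -/

/-- The unit vector `v` has a coordinate that exceeds all others in absolute value by a
factor `1 / ρ`. -/
def Dominated {n : ℕ} (ρ : ℝ) (v : EuclideanSpace ℝ (Fin n)) : Prop :=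
  ‖v‖ = 1 ∧ ∃ i, ∀ j, j ≠ i → |v j| ≤ ρ * |v i|

/-- Like `Dominated`, with a positive dominating coordinate. -/
def PosDominated {n : ℕ} (ρ : ℝ) (v : EuclideanSpace ℝ (Fin n)) : Prop :=
  ‖v‖ = 1 ∧ ∃ i, 0 < v i ∧ ∀ j, j ≠ i → |v j| ≤ ρ * v i

lemma PosDominated.dominated {n : ℕ} {ρ : ℝ} {v : EuclideanSpace ℝ (Fin n)}
    (h : PosDominated ρ v) : Dominated ρ v := by
  obtain ⟨h1, i, hi, h2⟩ := h
  exact ⟨h1, i, fun j hj => by rw [abs_of_pos hi]; exact h2 j hj⟩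

lemma measurableSet_posDominated {n : ℕ} (ρ : ℝ) :
    MeasurableSet {v : EuclideanSpace ℝ (Fin n) | PosDominated ρ v} := by
  simp only [PosDominated, Set.ofPred_and, Set.ofPred_exists, Set.ofPred_forall]
  exact (measurableSet_eq_fun (by fun_prop) (by fun_prop)).inter
    (MeasurableSet.iUnion fun i => (measurableSet_lt (by fun_prop) (by fun_prop)).inter
      (MeasurableSet.iInter fun j => MeasurableSet.iInter fun _ =>
      measurableSet_le (by fun_prop) (by fun_prop)))

lemma measurableSet_accurate {n t : ℕ} (ε : ℝ) :
    MeasurableSet {p : EuclideanSpace ℝ (Fin n) × (Fin t → EuclideanSpace ℝ (Fin n)) |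
      Accurate ε p.1 p.2} := by
  simp only [Accurate, Set.ofPred_forall]
  refine MeasurableSet.iInter fun i => (isClosed_le ?_ continuous_const).measurableSet
  have h := (EuclideanSpace.proj (𝕜 := ℝ) i).continuous.comp
    (continuous_rawUpdate (n := n) (t := t))
  have h' : Continuous fun p : EuclideanSpace ℝ (Fin n) × (Fin t → EuclideanSpace ℝ (Fin n)) =>
    rawUpdate p.2 p.1 i := h
  exact (h'.sub (by fun_prop)).abs

/-- The dominating coordinate satisfies `u i ^ 2 ≥ 1 / n`, so an error `ε` is relatively at most `n
* ε`. Since the update is close to squares, the dominating coordinate becomes positive whatever its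
former sign. -/
lemma Dominated.step {n t : ℕ} {ρ ε : ℝ} (hρ0 : 0 ≤ ρ) (hρ1 : ρ ≤ 1) (hε0 : 0 ≤ ε)
    (hε : 3 * (n * ε) ≤ 1) {u : EuclideanSpace ℝ (Fin n)} (hu : Dominated ρ u)
    {x : Fin t → EuclideanSpace ℝ (Fin n)} (hx : Accurate ε u x) :
    PosDominated (ρ ^ 2 + 3 * (n * ε)) (step x u) := by
  obtain ⟨hu1, i, hi⟩ := hu
  have hn : 0 < n := i.pos
  have hn' : (0 : ℝ) < n := by exact_mod_cast hn
  set b := 3 * (n * ε) with hb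
  have hb0 : 0 ≤ b := by positivity
  have hsq : ∀ j, j ≠ i → u j ^ 2 ≤ ρ ^ 2 * u i ^ 2 := by
    intro j hj
    rw [← sq_abs (u j), ← sq_abs (u i), ← mul_pow]
    exact pow_le_pow_left₀ (abs_nonneg _) (hi j hj) 2
  have hle : ∀ j, u j ^ 2 ≤ u i ^ 2 := by
    intro j
    by_cases hj : j = i
    · rw [hj]
    · exact (hsq j hj).trans (mul_le_of_le_one_left (sq_nonneg _) (pow_le_one₀ hρ0 hρ1))
  have hmax : 1 ≤ n * u i ^ 2 := by
    have h1 : ∑ j, u j ^ 2 = 1 := by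
      rw [← EuclideanSpace.real_norm_sq_eq, hu1, one_pow]
    calc (1 : ℝ) = ∑ j, u j ^ 2 := h1.symm
      _ ≤ ∑ _j : Fin n, u i ^ 2 := Finset.sum_le_sum fun j _ => hle j
      _ = n * u i ^ 2 := by simp
  set w := rawUpdate x u with hw
  have hwi : u i ^ 2 - ε ≤ w i := by have := (abs_le.1 (hx i)).1; linarith
  have hbu : 3 * ε ≤ b * u i ^ 2 := by
    have : b * u i ^ 2 = 3 * ε * (n * u i ^ 2) := by rw [hb]; ring
    rw [this]
    exact le_mul_of_one_le_right (by positivity) hmax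
  have hui : ε < u i ^ 2 := by
    have : (n : ℝ) * ε < n * u i ^ 2 := by linarith
    exact lt_of_mul_lt_mul_left this hn'.le
  have hwpos : 0 < w i := by linarith
  have hw0 : w ≠ 0 := by
    intro h
    rw [h] at hwpos
    simp at hwpos
  have hnw : 0 < ‖w‖ := norm_pos_iff.2 hw0
  have hstep : ∀ j, SimplexVertex.step x u j = ‖w‖⁻¹ * w j := fun j => rfl
  refine ⟨?_, i, ?_, fun j hj => ?_⟩
  · rw [SimplexVertex.step, norm_smul, norm_inv, norm_norm, ← hw, inv_mul_cancel₀ hnw.ne']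
  · rw [hstep]; positivity
  · rw [hstep, hstep, abs_mul, abs_of_pos (inv_pos.2 hnw), mul_left_comm]
    refine mul_le_mul_of_nonneg_left ?_ (inv_pos.2 hnw).le
    have h1 : |w j| ≤ ρ ^ 2 * u i ^ 2 + ε := by
      have h2 := abs_le.1 (hx j)
      have h3 := hsq j hj
      have h4 := sq_nonneg (u j)
      refine abs_le.2 ⟨?_, by linarith⟩
      have : 0 ≤ ρ ^ 2 * u i ^ 2 := by positivity
      linarith
    have hρ2 : ρ ^ 2 ≤ 1 := pow_le_one₀ hρ0 hρ1
    calc |w j| ≤ ρ ^ 2 * u i ^ 2 + ε := h1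
      -- Of the `3 * ε` contained in `b * u i ^ 2`, one `ε` pays for the left side and two for `(ρ ^
      -- 2 + b) * ε`, as `ρ ^ 2` and `b` are at most `1`.
      _ ≤ (ρ ^ 2 + b) * (u i ^ 2 - ε) := by nlinarith
      _ ≤ (ρ ^ 2 + b) * w i := by gcongr

lemma PosDominated.exists_dist_sq_le {n : ℕ} {ρ : ℝ} {v : EuclideanSpace ℝ (Fin n)}
    (h : PosDominated ρ v) : ∃ i, dist v (EuclideanSpace.single i 1) ^ 2 ≤ n * ρ ^ 2 := by
  obtain ⟨h1, i, hi, h2⟩ := h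
  refine ⟨i, ?_⟩
  have hd : dist v (EuclideanSpace.single i 1) ^ 2 = 2 - 2 * v i := by
    rw [dist_eq_norm, norm_sub_sq_real, EuclideanSpace.inner_single_right, h1]
    simp
    ring
  have hsum : ∑ j, v j ^ 2 = 1 := by
    rw [← EuclideanSpace.real_norm_sq_eq, h1, one_pow]
  have hle : (1 : ℝ) ≤ v i ^ 2 * (1 + n * ρ ^ 2) := by
    have hother : ∀ j ∈ Finset.univ.erase i, v j ^ 2 ≤ ρ ^ 2 * v i ^ 2 := by
      intro j hj
      rw [← sq_abs (v j), ← mul_pow]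
      exact pow_le_pow_left₀ (abs_nonneg _) (h2 j (Finset.ne_of_mem_erase hj)) 2
    calc (1 : ℝ) = v i ^ 2 + ∑ j ∈ Finset.univ.erase i, v j ^ 2 := by
          rw [Finset.add_sum_erase _ (fun j => v j ^ 2) (Finset.mem_univ i), hsum]
      _ ≤ v i ^ 2 + ∑ j ∈ Finset.univ.erase i, ρ ^ 2 * v i ^ 2 := by
          gcongr with j hj; exact hother j hj
      _ ≤ v i ^ 2 + ∑ j : Fin n, ρ ^ 2 * v i ^ 2 := by
          gcongr
          exact Finset.erase_subset _ _
      _ = v i ^ 2 * (1 + n * ρ ^ 2) := by simp; ring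
  rw [hd]
  set s := (n : ℝ) * ρ ^ 2 with hs
  have hs0 : 0 ≤ s := by positivity
  by_contra hcon
  rw [not_le] at hcon
  have hlt : v i < 1 - s / 2 := by linarith
  have hs2 : s < 2 := by linarith
  have hvsq : v i ^ 2 < (1 - s / 2) ^ 2 := by gcongr
  have : v i ^ 2 * (1 + s) < (1 - s / 2) ^ 2 * (1 + s) := by gcongr
  -- The contradiction comes from `(1 - s / 2) ^ 2 * (1 + s) = 1 - s ^ 2 * (3 - s) / 4`.
  nlinarith [mul_nonneg (sq_nonneg s) (by linarith : 0 ≤ 3 - s)]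

/-! ### The scalar recursion `y ↦ y ^ 2 + b`. -/

section Recursion

variable {b x : ℝ}

lemma iterate_sq_add_nonneg (hb : 0 ≤ b) (hx : 0 ≤ x) (k : ℕ) :
    0 ≤ (fun y : ℝ => y ^ 2 + b)^[k] x := by
  cases k with
  | zero => exact hx
  | succ k => rw [Function.iterate_succ_apply']; positivity

/-- The interval up to `1 - g` is invariant, as `(1 - g) ^ 2 + g * (1 - g) = 1 - g`. This keeps the
ratio below `1`, as `Dominated.step` requires. -/
lemma iterate_sq_add_le_self {g : ℝ} (hb : 0 ≤ b) (hx : 0 ≤ x) (hxg : x ≤ 1 - g)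
    (hbg : b ≤ g * (1 - g)) (k : ℕ) : (fun y : ℝ => y ^ 2 + b)^[k] x ≤ 1 - g := by
  induction k with
  | zero => exact hxg
  | succ k ih =>
    rw [Function.iterate_succ_apply']
    have h0 := iterate_sq_add_nonneg hb hx k
    nlinarith

lemma iterate_sq_add_le_of_le_half (hb : 0 ≤ b) (hb' : b ≤ 1 / 18) (hx : 0 ≤ x) (hx' : x ≤ 1 / 2)
    (k : ℕ) : (fun y : ℝ => y ^ 2 + b)^[k] x ≤ x ^ 2 ^ k + 3 * b := by
  cases k with
  | zero => simp [hb]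
  | succ k =>
    induction k with
    | zero => simp; linarith
    | succ k ih =>
      rw [Function.iterate_succ_apply']
      have h0 := iterate_sq_add_nonneg hb hx (k + 1)
      set a := x ^ 2 ^ (k + 1) with ha
      have ha0 : 0 ≤ a := by positivity
      have ha4 : a ≤ 1 / 4 := by
        calc a ≤ (1 / 2 : ℝ) ^ 2 ^ (k + 1) := by rw [ha]; gcongr
          _ ≤ (1 / 2 : ℝ) ^ 2 := by
            refine pow_le_pow_of_le_one (by norm_num) (by norm_num) ?_
            exact Nat.le_self_pow (by omega) 2
          _ = 1 / 4 := by norm_num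
      have e : x ^ 2 ^ (k + 1 + 1) = a ^ 2 := by rw [ha, ← pow_mul, ← pow_succ]
      rw [e]
      have : ((fun y : ℝ => y ^ 2 + b)^[k + 1] x) ^ 2 ≤ (a + 3 * b) ^ 2 := by gcongr
      -- In `(a + 3 * b) ^ 2 + b`, the bounds `a ≤ 1 / 4` and `b ≤ 1 / 18` give `6 * a * b + 9 * b ^
      -- 2 + b ≤ 3 * b`. The bound on `a` needs one squaring first, hence the separate first
      -- iterate.
      nlinarith

/-- While `x > 1 / 2`, the additive error is multiplicative, `b ≤ 4 * b * x ^ 2`, so `x * (1 + 4 *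
b)` is at most squared in each iteration. Below `1 / 2` the previous lemma takes over. -/
lemma iterate_sq_add_le (hb : 0 ≤ b) (hb' : b ≤ 1 / 18) (hx : 0 ≤ x)
    (hx' : x * (1 + 4 * b) ≤ 1) (k : ℕ) :
    (fun y : ℝ => y ^ 2 + b)^[k] x ≤ (x * (1 + 4 * b)) ^ 2 ^ k + 3 * b := by
  induction k generalizing x with
  | zero => simp; nlinarith
  | succ k ih =>
    by_cases hhalf : x ≤ 1 / 2
    · refine (iterate_sq_add_le_of_le_half hb hb' hx hhalf (k + 1)).trans ?_
      gcongr
      exact le_mul_of_one_le_right hx (by linarith)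
    · rw [not_le] at hhalf
      have hle : (x ^ 2 + b) * (1 + 4 * b) ≤ (x * (1 + 4 * b)) ^ 2 := by
        have : x ^ 2 + b ≤ x ^ 2 * (1 + 4 * b) := by
          have h4 : 1 ≤ 4 * x ^ 2 := by nlinarith
          nlinarith
        calc (x ^ 2 + b) * (1 + 4 * b) ≤ x ^ 2 * (1 + 4 * b) * (1 + 4 * b) := by gcongr
          _ = (x * (1 + 4 * b)) ^ 2 := by ring
      rw [Function.iterate_succ_apply]
      have h0 : 0 ≤ (x ^ 2 + b) * (1 + 4 * b) := by positivity
      refine (ih (by positivity) (hle.trans (pow_le_one₀ (by positivity) hx'))).trans ?_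
      rw [pow_succ' 2 k, pow_mul]
      gcongr

end Recursion

/-! ### The starting point has a gap between its two largest coordinates. -/

/-- The vectors whose `i`-th and `j`-th coordinates have nearly the same absolute value. -/
def nearTie {n : ℕ} (g : ℝ) (i j : Fin n) : Set (EuclideanSpace ℝ (Fin n)) :=
  {v | (1 - g) * |v i| < |v j| ∧ |v j| ≤ |v i|}

lemma measurableSet_nearTie {n : ℕ} (g : ℝ) (i j : Fin n) : MeasurableSet (nearTie g i j) := by
  simp only [nearTie, Set.ofPred_and]
  exact (measurableSet_lt (by fun_prop) (by fun_prop)).inter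
    (measurableSet_le (by fun_prop) (by fun_prop))

/-- Shrinking coordinate `j` by `1 - g` maps the part of the ball with `|v j| ≤ |v i|` into the part
with `|v j| ≤ (1 - g) * |v i|`, and its determinant is `1 - g`. Hence at most a fraction `g` of the
former lies outside the latter. -/
lemma volume_ball_inter_nearTie_le {n : ℕ} {g : ℝ} (hg0 : 0 < g) (hg1 : g < 1) {i j : Fin n}
    (hij : i ≠ j) :
    volume (Metric.ball 0 1 ∩ nearTie g i j) ≤
      ENNReal.ofReal g * volume (Metric.ball (0 : EuclideanSpace ℝ (Fin n)) 1) := by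
  set V : ℝ → Set (EuclideanSpace ℝ (Fin n)) :=
    fun s => Metric.ball 0 1 ∩ {v | |v j| ≤ s * |v i|} with hV
  have hVm : ∀ s, MeasurableSet (V s) := fun s =>
    Metric.isOpen_ball.measurableSet.inter (measurableSet_le (by fun_prop) (by fun_prop))
  have hfin : ∀ s, volume (V s) ≠ ⊤ := fun s =>
    ((measure_mono Set.inter_subset_left).trans_lt measure_ball_lt_top).ne
  set l := 1 - g with hl
  have hl0 : 0 < l := by linarith
  set D : EuclideanSpace ℝ (Fin n) →ₗ[ℝ] EuclideanSpace ℝ (Fin n) :=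
    (Matrix.diagonal (Function.update (fun _ => (1 : ℝ)) j l)).toLpLin 2 2 with hD
  have hDapp : ∀ v k, D v k = Function.update (fun _ => (1 : ℝ)) j l k * v k := by
    intro v k
    simp [hD, Matrix.toLpLin_apply, Matrix.mulVec_diagonal]
  have hDdet : LinearMap.det D = l := by
    rw [hD, LinearMap.det_toLpLin, Matrix.det_diagonal, Finset.prod_update_of_mem (Finset.mem_univ j)]
    simp
  have himg : D '' V 1 ⊆ V l := by
    rintro _ ⟨v, ⟨hv1, hv2⟩, rfl⟩
    have hv2' : |v j| ≤ |v i| := by simpa using hv2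
    have hj : D v j = l * v j := by rw [hDapp]; simp
    have hk : ∀ k, k ≠ j → D v k = v k := fun k hk => by
      rw [hDapp, Function.update_of_ne hk, one_mul]
    refine ⟨?_, ?_⟩
    · rw [mem_ball_zero_iff] at hv1 ⊢
      refine lt_of_le_of_lt ?_ hv1
      rw [← sq_le_sq₀ (norm_nonneg _) (norm_nonneg _), EuclideanSpace.real_norm_sq_eq,
        EuclideanSpace.real_norm_sq_eq]
      refine Finset.sum_le_sum fun k _ => ?_
      by_cases h : k = j
      · subst h
        rw [hj, mul_pow]
        exact mul_le_of_le_one_left (sq_nonneg _) (pow_le_one₀ hl0.le (by linarith))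
      · rw [hk k h]
    · rw [Set.mem_ofPred_eq, hj, hk i hij, abs_mul, abs_of_pos hl0]
      gcongr
  have hvol : ENNReal.ofReal l * volume (V 1) ≤ volume (V l) := by
    have h := Measure.addHaar_image_linearMap (volume : Measure (EuclideanSpace ℝ (Fin n))) D (V 1)
    rw [hDdet, abs_of_pos hl0] at h
    rw [← h]
    exact measure_mono himg
  have hsub : Metric.ball 0 1 ∩ nearTie g i j ⊆ V 1 \ V l := by
    rintro v ⟨hv1, hv2, hv3⟩
    refine ⟨⟨hv1, by simpa using hv3⟩, fun h => ?_⟩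
    exact absurd h.2 (not_le.2 hv2)
  have hVsub : V l ⊆ V 1 := by
    rintro v ⟨hv1, hv2⟩
    have hv2' : |v j| ≤ l * |v i| := hv2
    refine ⟨hv1, ?_⟩
    rw [Set.mem_ofPred_eq]
    refine hv2'.trans ?_
    gcongr
    linarith
  have hone : ENNReal.ofReal g + ENNReal.ofReal l = 1 := by
    rw [← ENNReal.ofReal_add hg0.le hl0.le, hl]
    simp
  calc volume (Metric.ball 0 1 ∩ nearTie g i j) ≤ volume (V 1 \ V l) := measure_mono hsub
    _ = volume (V 1) - volume (V l) := measure_sdiff hVsub (hVm l).nullMeasurableSet (hfin l)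
    _ ≤ ENNReal.ofReal g * volume (V 1) := by
      rw [tsub_le_iff_right]
      calc volume (V 1) = ENNReal.ofReal g * volume (V 1) + ENNReal.ofReal l * volume (V 1) := by
            rw [← add_mul, hone, one_mul]
        _ ≤ _ := by gcongr
    _ ≤ _ := by
      gcongr
      exact Set.inter_subset_left

lemma uniformSphere_nearTie_le {n : ℕ} {g : ℝ} (hg0 : 0 < g) (hg1 : g < 1) {i j : Fin n}
    (hij : i ≠ j) :
    (uniformSphere n).map (↑) (nearTie g i j) ≤ ENNReal.ofReal g := by
  have hn : 0 < n := i.pos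
  have : Nonempty (Fin n) := ⟨i⟩
  rw [uniformSphere_map_coe hn, Measure.map_apply measurable_radial (measurableSet_nearTie g i j),
    ProbabilityTheory.cond_apply Metric.isOpen_ball.measurableSet]
  -- The near-tie set is invariant under positive scaling.
  have hpre : radial ⁻¹' nearTie g i j ⊆ nearTie g i j := by
    rintro v ⟨h1, h2⟩
    have hr : ∀ k, |radial v k| = ‖v‖⁻¹ * |v k| := fun k => by
      simp [radial, abs_mul]
    rw [hr, hr] at h1 h2
    have hv : 0 < ‖v‖⁻¹ := by
      refine lt_of_le_of_ne (by positivity) fun h0 => ?_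
      rw [← h0] at h1
      simp at h1
    refine ⟨?_, le_of_mul_le_mul_left h2 hv⟩
    rw [mul_left_comm] at h1
    exact lt_of_mul_lt_mul_left h1 hv.le
  have hb0 : volume (Metric.ball (0 : EuclideanSpace ℝ (Fin n)) 1) ≠ 0 :=
    (Metric.measure_ball_pos _ _ one_pos).ne'
  calc _ ≤ (volume (Metric.ball (0 : EuclideanSpace ℝ (Fin n)) 1))⁻¹ *
        (ENNReal.ofReal g * volume (Metric.ball (0 : EuclideanSpace ℝ (Fin n)) 1)) := by
        gcongr
        exact (measure_mono (Set.inter_subset_inter_right _ hpre)).trans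
          (volume_ball_inter_nearTie_le hg0 hg1 hij)
    _ = ENNReal.ofReal g := by
      rw [mul_left_comm, ENNReal.inv_mul_cancel hb0 measure_ball_lt_top.ne, mul_one]

lemma uniformSphere_not_dominated_le {n : ℕ} (hn : 0 < n) {g : ℝ} (hg0 : 0 < g) (hg1 : g < 1) :
    (uniformSphere n).map (↑) {v : EuclideanSpace ℝ (Fin n) | ¬ Dominated (1 - g) v} ≤
      ENNReal.ofReal (n ^ 2 * g) := by
  have : Nonempty (Fin n) := ⟨⟨0, hn⟩⟩
  set σ : Measure (EuclideanSpace ℝ (Fin n)) := (uniformSphere n).map (↑) with hσ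
  have hsub : {v : EuclideanSpace ℝ (Fin n) | ¬ Dominated (1 - g) v} ⊆
      {v | ‖v‖ ≠ 1} ∪ ⋃ i, ⋃ j, if i = j then ∅ else nearTie g i j := by
    intro v hv
    by_cases h1 : ‖v‖ = 1
    · right
      obtain ⟨i, hi⟩ := Finite.exists_max fun k => |v k|
      have hv' : ¬ ∀ j, j ≠ i → |v j| ≤ (1 - g) * |v i| := fun h => hv ⟨h1, i, h⟩
      push Not at hv'
      obtain ⟨j, hj, hlt⟩ := hv'
      refine Set.mem_iUnion.2 ⟨i, Set.mem_iUnion.2 ⟨j, ?_⟩⟩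
      rw [if_neg hj.symm]
      exact ⟨hlt, hi j⟩
    · exact Or.inl h1
  have hz : σ {v : EuclideanSpace ℝ (Fin n) | ‖v‖ ≠ 1} = 0 := by
    have hm : MeasurableSet {v : EuclideanSpace ℝ (Fin n) | ‖v‖ ≠ 1} :=
      (measurableSet_eq_fun measurable_norm measurable_const).compl
    rw [hσ, Measure.map_apply measurable_subtype_coe hm]
    refine measure_mono_null (t := ∅) (fun u hu => ?_) measure_empty
    exact hu (mem_sphere_zero_iff_norm.1 u.2)
  calc _ ≤ σ {v : EuclideanSpace ℝ (Fin n) | ‖v‖ ≠ 1} +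
        ∑ i, ∑ j, σ (if i = j then ∅ else nearTie g i j) :=
        (measure_mono hsub).trans ((measure_union_le _ _).trans (by
          gcongr
          refine (measure_iUnion_fintype_le _ _).trans (Finset.sum_le_sum fun i _ => ?_)
          exact measure_iUnion_fintype_le _ _))
    _ ≤ 0 + ∑ _i : Fin n, ∑ _j : Fin n, ENNReal.ofReal g := by
      rw [hz]
      gcongr with i _ j _
      split_ifs with h
      · simp
      · exact uniformSphere_nearTie_le hg0 hg1 h
    _ = ENNReal.ofReal (n ^ 2 * g) := by
      rw [ENNReal.ofReal_mul (by positivity), ENNReal.ofReal_pow (by positivity),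
        ENNReal.ofReal_natCast]
      simp
      ring

/-! ### Union bound over the iterations. -/

lemma outputLaw_succ_not_posDominated_le {n t r : ℕ} (hn : 4 ≤ n) (ht : 0 < t) {η ρ : ℝ}
    (hη : 0 ≤ η) (hρ0 : 0 ≤ ρ) (hρ1 : ρ ≤ 1) (hε : 3 * (n * ((n : ℝ) ^ 3 * η)) ≤ 1) :
    outputLaw t (r + 1) (LinearIsometryEquiv.refl ℝ (EuclideanSpace ℝ (Fin n)))
      {v | ¬ PosDominated (ρ ^ 2 + 3 * (n * ((n : ℝ) ^ 3 * η))) v} ≤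
    outputLaw t r (LinearIsometryEquiv.refl ℝ (EuclideanSpace ℝ (Fin n)))
      {v | ¬ Dominated ρ v} + ENNReal.ofReal (2 * n * Real.exp (-(2 * t * η ^ 2))) := by
  have hn0 : 0 < n := by omega
  have := isProbabilityMeasure_uniformSimplex hn0
    (LinearIsometryEquiv.refl ℝ (EuclideanSpace ℝ (Fin n)))
  have := isProbabilityMeasure_uniformSphere hn0
  set μ := outputLaw t r (LinearIsometryEquiv.refl ℝ (EuclideanSpace ℝ (Fin n))) with hμ
  set S := sampleLaw t (LinearIsometryEquiv.refl ℝ (EuclideanSpace ℝ (Fin n))) with hS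
  set q := ENNReal.ofReal (2 * n * Real.exp (-(2 * t * η ^ 2))) with hq
  have hm1 : MeasurableSet {v : EuclideanSpace ℝ (Fin n) |
      ¬ PosDominated (ρ ^ 2 + 3 * (n * ((n : ℝ) ^ 3 * η))) v} :=
    (measurableSet_posDominated _).compl
  have hm2 : MeasurableSet {p : EuclideanSpace ℝ (Fin n) × (Fin t → EuclideanSpace ℝ (Fin n)) |
      ‖p.1‖ = 1 ∧ ¬ Accurate ((n : ℝ) ^ 3 * η) p.1 p.2} :=
    (measurableSet_eq_fun (by fun_prop) measurable_const).inter (measurableSet_accurate _).compl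
  rw [outputLaw_succ, Measure.map_apply measurable_step hm1]
  have hsub : (fun p : EuclideanSpace ℝ (Fin n) × (Fin t → EuclideanSpace ℝ (Fin n)) =>
      step p.2 p.1) ⁻¹' {v | ¬ PosDominated (ρ ^ 2 + 3 * (n * ((n : ℝ) ^ 3 * η))) v} ⊆
      ({v | ¬ Dominated ρ v} ×ˢ Set.univ) ∪
        {p | ‖p.1‖ = 1 ∧ ¬ Accurate ((n : ℝ) ^ 3 * η) p.1 p.2} := by
    intro p hp
    by_cases hd : Dominated ρ p.1
    · exact Or.inr ⟨hd.1, fun ha => hp (hd.step hρ0 hρ1 (by positivity) hε ha)⟩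
    · exact Or.inl ⟨hd, trivial⟩
  refine (measure_mono hsub).trans ((measure_union_le _ _).trans ?_)
  gcongr
  · rw [Measure.prod_prod, measure_univ, mul_one]
  · rw [Measure.prod_apply hm2]
    calc _ ≤ ∫⁻ _, q ∂μ := by
          refine lintegral_mono fun u => ?_
          by_cases hu : ‖u‖ = 1
          · exact (measure_mono fun x hx => hx.2).trans (sampleLaw_not_accurate_le hn ht hη hu)
          · refine (measure_mono_null (t := ∅) (fun x hx => ?_) measure_empty).trans_le zero_le
            exact hu hx.1
      _ = q := by simp

lemma outputLaw_not_posDominated_le {n t : ℕ} (hn : 4 ≤ n) (ht : 0 < t) {η g : ℝ}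
    (hη : 0 ≤ η) (hg0 : 0 < g) (hg1 : g < 1) (hε : 3 * (n * ((n : ℝ) ^ 3 * η)) ≤ g * (1 - g))
    (k : ℕ) :
    outputLaw t (k + 1) (LinearIsometryEquiv.refl ℝ (EuclideanSpace ℝ (Fin n)))
      {v | ¬ PosDominated
        ((fun y : ℝ => y ^ 2 + 3 * (n * ((n : ℝ) ^ 3 * η)))^[k + 1] (1 - g)) v} ≤
    ENNReal.ofReal (n ^ 2 * g) +
      (k + 1 : ℕ) * ENNReal.ofReal (2 * n * Real.exp (-(2 * t * η ^ 2))) := by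
  have hn0 : 0 < n := by omega
  have := isProbabilityMeasure_uniformSphere hn0
  have hb0 : 0 ≤ 3 * (n * ((n : ℝ) ^ 3 * η)) := by positivity
  have hx0 : 0 ≤ 1 - g := by linarith
  have hρ0 := iterate_sq_add_nonneg hb0 hx0
  have hρ1 := iterate_sq_add_le_self hb0 hx0 le_rfl hε
  have hε1 : 3 * (n * ((n : ℝ) ^ 3 * η)) ≤ 1 := hε.trans (by nlinarith)
  induction k with
  | zero =>
    have h := outputLaw_succ_not_posDominated_le (r := 0) hn ht hη hx0 (by linarith) hε1
    refine h.trans ?_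
    rw [outputLaw_zero]
    have := uniformSphere_not_dominated_le hn0 hg0 hg1
    simpa using add_le_add_left this _
  | succ k ih =>
    have h := outputLaw_succ_not_posDominated_le (r := k + 1) hn ht hη (hρ0 (k + 1))
      ((hρ1 (k + 1)).trans (by linarith)) hε1
    rw [Function.iterate_succ_apply']
    refine h.trans ?_
    have hmono := (measure_mono (μ := outputLaw t (k + 1)
      (LinearIsometryEquiv.refl ℝ (EuclideanSpace ℝ (Fin n)))) fun v
        (hv : ¬ Dominated ((fun y : ℝ => y ^ 2 + 3 * (n * ((n : ℝ) ^ 3 * η)))^[k + 1] (1 - g)) v)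
        (hv' : PosDominated _ v) => hv hv'.dominated).trans ih
    refine (add_le_add_left hmono _).trans ?_
    refine le_of_eq ?_
    push_cast
    ring

/-! ### Numerical choice of the parameters. -/

lemma mul_sq_two_mul_rpow_le {N c : ℝ} (hN : 2 ≤ N) :
    N * (2 * N ^ (-(c + 3))) ^ 2 ≤ (1 / N ^ c) ^ 2 := by
  have hN0 : 0 < N := by linarith
  have e : N ^ (-(c + 3)) = 1 / N ^ c * (N ^ 3)⁻¹ := by
    rw [Real.rpow_neg hN0.le, Real.rpow_add hN0, mul_inv, one_div]
    norm_cast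
  have h5 : 4 / N ^ 5 ≤ 1 := by
    rw [div_le_one (by positivity)]
    calc (4 : ℝ) ≤ 2 ^ 5 := by norm_num
      _ ≤ N ^ 5 := by gcongr
  calc N * (2 * N ^ (-(c + 3))) ^ 2 = 4 / N ^ 5 * (1 / N ^ c) ^ 2 := by
        rw [e]; field_simp; norm_num
    _ ≤ 1 * (1 / N ^ c) ^ 2 := by gcongr
    _ = (1 / N ^ c) ^ 2 := one_mul _

lemma iterate_sq_add_le_rpow {N c b g : ℝ} {r : ℕ} (hN : 0 < N) (hb0 : 0 ≤ b)
    (hbg : 8 * b ≤ g) (hg : g ≤ 4 / 9) (hr : (c + 3) * Real.log N ≤ g / 2 * 2 ^ r)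
    (hb3 : 3 * b ≤ N ^ (-(c + 3))) :
    (fun y : ℝ => y ^ 2 + b)^[r] (1 - g) ≤ 2 * N ^ (-(c + 3)) := by
  have hx0 : 0 ≤ 1 - g := by linarith
  -- Since `8 * b ≤ g`, the factor is at most `1 - g / 2`.
  have hfac : (1 - g) * (1 + 4 * b) ≤ Real.exp (-(g / 2)) := by
    have := Real.add_one_le_exp (-(g / 2))
    nlinarith [mul_nonneg (by linarith : 0 ≤ g) hb0]
  have hfac1 : (1 - g) * (1 + 4 * b) ≤ 1 := hfac.trans (Real.exp_le_one_iff.2 (by linarith))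
  have hit := iterate_sq_add_le hb0 (by linarith) hx0 hfac1 r
  have hpow : ((1 - g) * (1 + 4 * b)) ^ 2 ^ r ≤ N ^ (-(c + 3)) := by
    calc ((1 - g) * (1 + 4 * b)) ^ 2 ^ r ≤ Real.exp (-(g / 2)) ^ 2 ^ r := by gcongr
      _ = Real.exp (-(g / 2 * 2 ^ r)) := by
        rw [← Real.exp_nat_mul]
        congr 1
        push_cast
        ring
      _ ≤ Real.exp (Real.log N * -(c + 3)) := Real.exp_le_exp.2 (by linarith)
      _ = N ^ (-(c + 3)) := (Real.rpow_def_of_pos hN _).symm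
  linarith

/-- Numerical facts about the parameters: `η` is the accuracy of each coordinate of the sample
mean, and `g` the relative gap between the two largest coordinates of the starting point. -/
lemma parameter_bounds {n : ℕ} (hn : 20 < n) {c δ : ℝ} (hc : 0 < c) (hδ0 : 0 < δ) (hδ1 : δ < 1)
    {r t : ℕ} (hr : r = ⌈Real.logb 2 (4 * (c + 3) * (n : ℝ) ^ 2 * Real.log n / δ)⌉₊)
    (ht : t = ⌈(2 : ℝ) ^ 17 * (n : ℝ) ^ (2 * c + 22) * (1 / δ) ^ 2 *
      Real.log (2 * (n : ℝ) ^ 5 * r / δ)⌉₊) :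
    0 < r ∧ 0 < t ∧ ∃ η g : ℝ, 0 ≤ η ∧ 0 < g ∧ g < 1 ∧
      3 * (n * ((n : ℝ) ^ 3 * η)) ≤ g * (1 - g) ∧
      n ^ 2 * g + r * (2 * n * Real.exp (-(2 * t * η ^ 2))) ≤ δ ∧
      n * ((fun y : ℝ => y ^ 2 + 3 * (n * ((n : ℝ) ^ 3 * η)))^[r] (1 - g)) ^ 2 ≤
        (1 / (n : ℝ) ^ c) ^ 2 := by
  set N : ℝ := (n : ℝ) with hN
  have hN21 : (21 : ℝ) ≤ N := by rw [hN]; exact_mod_cast hn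
  have hN0 : 0 < N := by linarith
  have hlogN : 1 ≤ Real.log N := by
    rw [Real.le_log_iff_exp_le hN0]
    linarith [Real.exp_one_lt_d9]
  set A := 4 * (c + 3) * N ^ 2 * Real.log N / δ with hA
  have hA1 : 1 < A := by
    rw [hA, lt_div_iff₀ hδ0]
    have : (12 : ℝ) * 1 * 1 ≤ 4 * (c + 3) * N ^ 2 * Real.log N := by
      gcongr
      · linarith
      · nlinarith
    linarith
  have hr0 : 0 < r := by
    rw [hr, Nat.ceil_pos]
    exact Real.logb_pos (by norm_num) hA1
  have hrpow : A ≤ 2 ^ r := by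
    have h1 : Real.logb 2 A ≤ r := by rw [hr]; exact Nat.le_ceil _
    rw [Real.logb_le_iff_le_rpow (by norm_num) (by linarith)] at h1
    exact_mod_cast h1
  have hr1 : (1 : ℝ) ≤ r := by exact_mod_cast hr0
  set L := Real.log (2 * N ^ 5 * r / δ) with hL
  have hM1 : 1 < 2 * N ^ 5 * r / δ := by
    rw [lt_div_iff₀ hδ0]
    have h5 : (1 : ℝ) ≤ N ^ 5 := one_le_pow₀ (by linarith)
    nlinarith [mul_le_mul h5 hr1 zero_le_one (by positivity)]
  have hL0 : 0 < L := Real.log_pos hM1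
  set T := (2 : ℝ) ^ 17 * N ^ (2 * c + 22) * (1 / δ) ^ 2 * L with hT
  have hT0 : 0 < T := by positivity
  have htT : T ≤ t := by rw [ht]; exact Nat.le_ceil _
  have ht0 : 0 < t := by rw [ht, Nat.ceil_pos]; exact hT0
  -- This `η` makes `2 * T * η ^ 2 = L`, so one sample fails with probability at most `δ / N ^ 4 /
  -- r`. The choice of `g` makes a bad start cost exactly `δ / 2`.
  set η := δ / 2 ^ 9 * N ^ (-(c + 11)) with hη
  set g := δ / (2 * N ^ 2) with hg
  have hg0 : 0 < g := by positivity
  have hN2 : 441 ≤ N ^ 2 := by nlinarith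
  have hg1 : g ≤ 1 / 800 := by
    rw [hg, div_le_iff₀ (by positivity)]
    linarith
  set b := 3 * (N * (N ^ 3 * η)) with hb
  have hη0 : 0 < η := by positivity
  have hb0 : 0 ≤ b := by positivity
  have hbN : b = 3 * δ / 2 ^ 9 * N ^ (-(c + 7)) := by
    have : N ^ (-(c + 7)) = N ^ 4 * N ^ (-(c + 11)) := by
      rw [← Real.rpow_natCast, ← Real.rpow_add hN0]
      congr 1
      push_cast
      ring
    rw [hb, hη, this]
    ring
  have hN2inv : N ^ (-(c + 7)) ≤ (N ^ 2)⁻¹ := by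
    rw [← Real.rpow_natCast, ← Real.rpow_neg hN0.le]
    refine Real.rpow_le_rpow_of_exponent_le (by linarith) ?_
    push_cast
    linarith
  have hbg : 8 * b ≤ g := by
    calc 8 * b = 3 * δ / 2 ^ 6 * N ^ (-(c + 7)) := by rw [hbN]; ring
      _ ≤ 3 * δ / 2 ^ 6 * (N ^ 2)⁻¹ := by gcongr
      _ ≤ δ / 2 * (N ^ 2)⁻¹ := by gcongr ?_ * _; linarith
      _ = g := by rw [hg]; field_simp
  refine ⟨hr0, ht0, η, g, hη0.le, hg0, by linarith, by nlinarith, ?_, ?_⟩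
  · have h1 : L ≤ 2 * t * η ^ 2 := by
      have hη2 : η ^ 2 = δ ^ 2 / 2 ^ 18 * N ^ (-(2 * c + 22)) := by
        have : N ^ (-(2 * c + 22)) = (N ^ (-(c + 11))) ^ 2 := by
          rw [← Real.rpow_natCast, ← Real.rpow_mul hN0.le]
          congr 1
          push_cast
          ring
        rw [hη, this]
        ring
      calc L = 2 * T * η ^ 2 := by
            rw [hη2, hT, Real.rpow_neg hN0.le]
            field_simp
        _ ≤ 2 * t * η ^ 2 := by gcongr
    have h2 : Real.exp (-(2 * t * η ^ 2)) ≤ δ / (2 * N ^ 5 * r) := by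
      calc Real.exp (-(2 * t * η ^ 2)) ≤ Real.exp (-L) := by gcongr
        _ = δ / (2 * N ^ 5 * r) := by
          rw [Real.exp_neg, hL, Real.exp_log (by linarith), inv_div]
    have h3 : r * (2 * N * Real.exp (-(2 * t * η ^ 2))) ≤ δ / 2 := by
      calc r * (2 * N * Real.exp (-(2 * t * η ^ 2))) ≤ r * (2 * N * (δ / (2 * N ^ 5 * r))) := by
            gcongr
        _ = δ / N ^ 4 := by field_simp
        _ ≤ δ / 2 := by
          gcongr
          nlinarith
    have h4 : N ^ 2 * g = δ / 2 := by rw [hg]; field_simp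
    linarith
  -- The number of iterations is calibrated so that `g / 2 * A` equals the left side.
  · have hgA : (c + 3) * Real.log N ≤ g / 2 * 2 ^ r := by
      have e : g / 2 * A = (c + 3) * Real.log N := by
        rw [hg, hA]; field_simp
        norm_num
      rw [← e]
      gcongr
    have hb3 : 3 * b ≤ N ^ (-(c + 3)) := by
      have h1 : N ^ (-(c + 7)) ≤ N ^ (-(c + 3)) :=
        Real.rpow_le_rpow_of_exponent_le (by linarith) (by linarith)
      have h2 : 3 * (3 * δ / 2 ^ 9) ≤ 1 := by linarith
      calc 3 * b = 3 * (3 * δ / 2 ^ 9) * N ^ (-(c + 7)) := by rw [hbN, mul_assoc]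
        _ ≤ 1 * N ^ (-(c + 3)) := by gcongr
        _ = N ^ (-(c + 3)) := one_mul _
    have hle := iterate_sq_add_le_rpow hN0 hb0 hbg (by linarith) hgA hb3
    have hit0 := iterate_sq_add_nonneg (x := 1 - g) hb0 (by linarith) r
    exact (mul_le_mul_of_nonneg_left (pow_le_pow_left₀ hit0 hle 2) hN0.le).trans
      (mul_sq_two_mul_rpow_le (by linarith))

end SimplexVertex

theorem mainTheorem2 (n : ℕ) (hn : 20 < n) (c : ℝ) (hc : 0 < c)
    (δ : ℝ) (hδ0 : 0 < δ) (hδ1 : δ < 1)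
    (R : EuclideanSpace ℝ (Fin n) ≃ₗᵢ[ℝ] EuclideanSpace ℝ (Fin n))
    (hR : R (SimplexVertex.ones n) = SimplexVertex.ones n)
    (r t : ℕ)
    (hr : r = ⌈Real.logb 2 (4 * (c + 3) * (n : ℝ) ^ 2 * Real.log n / δ)⌉₊)
    (ht : t = ⌈(2 : ℝ) ^ 17 * (n : ℝ) ^ (2 * c + 22) * (1 / δ) ^ 2 *
      Real.log (2 * (n : ℝ) ^ 5 * r / δ)⌉₊) :
    ENNReal.ofReal (1 - δ) ≤ SimplexVertex.runLaw t r R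
        {ω | ∃ i : Fin n, dist (SimplexVertex.output r (ω.1 : EuclideanSpace ℝ (Fin n)) ω.2)
          (SimplexVertex.rotatedVertex R i) ≤ 1 / (n : ℝ) ^ c} ∧
    ∀ i : Fin n, SimplexVertex.runLaw t r R
        {ω | ∀ j : Fin n, j ≠ i →
          dist (SimplexVertex.output r (ω.1 : EuclideanSpace ℝ (Fin n)) ω.2)
              (SimplexVertex.rotatedVertex R i) <
            dist (SimplexVertex.output r (ω.1 : EuclideanSpace ℝ (Fin n)) ω.2)
              (SimplexVertex.rotatedVertex R j)} = 1 / (n : ENNReal) := by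
  open SimplexVertex MeasureTheory in
  obtain ⟨hr0, ht0, η, g, hη0, hg0, hg1, hε, hprob, hdist⟩ :=
    parameter_bounds hn hc hδ0 hδ1 hr ht
  refine ⟨?_, runLaw_nearest (by omega) ht0 hr0 R hR⟩
  have hn0 : 0 < n := by omega
  have := isProbabilityMeasure_uniformSimplex hn0
    (LinearIsometryEquiv.refl ℝ (EuclideanSpace ℝ (Fin n)))
  have := isProbabilityMeasure_uniformSphere hn0
  have hm : MeasurableSet {v : EuclideanSpace ℝ (Fin n) | ∃ i : Fin n,
      dist v (rotatedVertex R i) ≤ 1 / (n : ℝ) ^ c} := by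
    simp only [Set.ofPred_exists]
    exact MeasurableSet.iUnion fun i => measurableSet_le (by fun_prop) measurable_const
  have hrun : runLaw t r R {ω | ∃ i : Fin n,
      dist (output r (ω.1 : EuclideanSpace ℝ (Fin n)) ω.2) (rotatedVertex R i) ≤
        1 / (n : ℝ) ^ c} = outputLaw t r R {v | ∃ i : Fin n,
      dist v (rotatedVertex R i) ≤ 1 / (n : ℝ) ^ c} := runLaw_setOf_output R hm
  rw [hrun, outputLaw_eq_map hn0 R hR, Measure.map_apply R.continuous.measurable hm]
  set μ := outputLaw t r (LinearIsometryEquiv.refl ℝ (EuclideanSpace ℝ (Fin n))) with hμ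
  set ρ := (fun y : ℝ => y ^ 2 + 3 * (n * ((n : ℝ) ^ 3 * η)))^[r] (1 - g) with hρ
  have hbad : μ {v | ¬ PosDominated ρ v} ≤ ENNReal.ofReal δ := by
    obtain ⟨k, rfl⟩ : ∃ k, r = k + 1 := ⟨r - 1, by omega⟩
    refine (outputLaw_not_posDominated_le (by omega) ht0 hη0 hg0 hg1 hε k).trans ?_
    rw [← ENNReal.ofReal_natCast, ← ENNReal.ofReal_mul (by positivity),
      ← ENNReal.ofReal_add (by positivity) (by positivity)]
    exact ENNReal.ofReal_le_ofReal hprob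
  have hgood : ENNReal.ofReal (1 - δ) ≤ μ {v | PosDominated ρ v} := by
    have h1 := prob_compl_eq_one_sub (μ := μ) (measurableSet_posDominated (n := n) ρ).compl
    rw [compl_compl] at h1
    rw [h1, ENNReal.ofReal_sub _ hδ0.le, ENNReal.ofReal_one]
    exact tsub_le_tsub_left hbad _
  refine hgood.trans (measure_mono fun v hv => ?_)
  obtain ⟨i, hi⟩ := PosDominated.exists_dist_sq_le hv
  refine ⟨i, ?_⟩
  rw [rotatedVertex, R.dist_map]
  exact le_of_sq_le_sq (hi.trans hdist) (by positivity)
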